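/- Setting. Let $n\ge 0$, let $y_1<\dots<y_n$ be real numbers and $Y=\{y_1,\dots,y_n\}$. Let $\mathsf H=-\frac{d^2}{dx^2}$ be the free Schrödinger operator in $L^2(\mathbb R)$ with domain $H^2(\mathbb R)$; its resolvent set is $\varrho(\mathsf H)=\mathbb C\setminus[0,+\infty)$. Let $H^2(\mathbb R\setminus Y)$ be the space of $\psi\in L^2(\mathbb R)$ whose first and second distributional derivatives on $\mathbb R\setminus Y$ belong to $L^2$, and define $\widehat\tau:H^2(\mathbb R\setminus Y)\to\mathbb C^{2n}$ by $$\widehat\tau\psi=\big((\langle\psi\rangle_{y_k},\langle\psi'\rangle_{y_k})\big)_{k=1}^n,\qquad \langle f\rangle_y=\tfrac12\big(f(y^-)+f(y^+)\big).$$ Let $\widehat S$ be the restriction of $\mathsf H$ to $\{\psi\in H^2(\mathbb R):\widehat\tau\psi=0\}$. For $z\in\varrho(\mathsf H)$ put $$\widehat g_z(x)=\frac{e^{i\sqrt z\,|x|}}{2i\sqrt z}\quad(\operatorname{Im}\sqrt z>0),$$ $$[\widehat G_z\xi](x)=\sum_{k=1}^n\big(\widehat g_z(y_k-x)\,\xi_{k,1}+\widehat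 g_z'(y_k-x)\,\xi_{k,2}\big),\qquad \xi=((\xi_{k,1},\xi_{k,2}))_{k=1}^n\in\mathbb C^{2n};$$ then $\widehat G_z=(\widehat\tau(-\mathsf H+\bar z)^{-1})^*:\mathbb C^{2n}\to L^2(\mathbb R)$. Identify $L^2(\mathbb R;\mathbb C^2)=L^2(\mathbb R)\oplus L^2(\mathbb R)$, $H^2(\mathbb R;\mathbb C^2)=H^2(\mathbb R)\oplus H^2(\mathbb R)$ and $\mathbb C^{4n}=\mathbb C^{2n}\oplus\mathbb C^{2n}$, and write $L\mathbb 1=L\oplus L$ for a linear operator $L$. Theorem. The operator $\widehat S\mathbb 1$ in $L^2(\mathbb R;\mathbb C^2)$ is densely defined, closed and symmetric, with defect indices $(4n,4n)$. The set of its self-adjoint extensions is parametrized, bijectively, by the couples $(\widehat\Pi,\widehat\Theta)$, where $\widehat\Pi:\mathbb C^{4n}\to\mathbb C^{4n}$ is an orthogonal projector and $\widehat\Theta:\operatorname{ran}(\widehat\Pi)\to\operatorname{ran}(\widehat\Pi)$ is symmetric. The extension $\widehat{\mathsf H}_{\widehat\Pi,\widehat\Theta}$ that corresponds to $(\widehat\Pi,\widehat\Theta)$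 has the following properties. 1. For every $z\in\varrho(\widehat{\mathsf H}_{\widehat\Pi,\widehat\Theta})\cap\varrho(\mathsf H)$ the operator $\widehat\Theta-\widehat\Pi(\widehat\tau\widehat G_z\mathbb 1)\widehat\Pi$ is a bijection of $\operatorname{ran}(\widehat\Pi)$ and $$(-\widehat{\mathsf H}_{\widehat\Pi,\widehat\Theta}+z)^{-1}=(-\mathsf H+z)^{-1}\mathbb 1+(\widehat G_z\mathbb 1)\widehat\Pi\big(\widehat\Theta-\widehat\Pi(\widehat\tau\widehat G_z\mathbb 1)\widehat\Pi\big)^{-1}\widehat\Pi(\widehat G_{\bar z}^*\mathbb 1).$$ 2. For every $z\in\varrho(\mathsf H)$, $$\operatorname{dom}(\widehat{\mathsf H}_{\widehat\Pi,\widehat\Theta})=\{\Psi\in L^2(\mathbb R;\mathbb C^2):\Psi=\Psi_z+(\widehat G_z\mathbb 1)\widehat\xi,\ \Psi_z\in H^2(\mathbb R;\mathbb C^2),\ \widehat\xi\in\operatorname{ran}(\widehat\Pi),\ \widehat\Pi(\widehat\tau\mathbb 1)\Psi=\widehat\Theta\widehat\xi\},$$ and for $\Psi=\Psi_z+(\widehat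 G_z\mathbb 1)\widehat\xi$ in this domain $$(-\widehat{\mathsf H}_{\widehat\Pi,\widehat\Theta}+z)\Psi=(-\mathsf H+z)\mathbb 1\,\Psi_z.$$ 3. The decomposition $\Psi=\Psi_z+(\widehat G_z\mathbb 1)\widehat\xi$ with $\Psi_z\in H^2(\mathbb R;\mathbb C^2)$ and $\widehat\xi\in\operatorname{ran}(\widehat\Pi)$ is unique for each $z\in\varrho(\mathsf H)$, and $\widehat\xi$ does not depend on $z$. -/

import Mathlib

open MeasureTheory Filter Topology Set
open scoped ContDiff ComplexConjugate InnerProductSpace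

noncomputable section

namespace PointInteraction

/-- The Hilbert space `L²(ℝ)` of complex-valued square integrable functions. -/
abbrev L2R : Type := Lp ℂ 2 (volume : Measure ℝ)

/-- The Hilbert space direct sum `X ⊕ X`. In particular `Dbl L2R` is
`L²(ℝ) ⊕ L²(ℝ) = L²(ℝ; ℂ²)`. -/
abbrev Dbl (X : Type) : Type := PiLp 2 (fun _ : Fin 2 => X)

/-- `ℂ²ⁿ`, written as `n` blocks of length `2`: the coordinate `(k, l)` is the `l`-th entry of the
`k`-th block. -/
abbrev C2n (n : ℕ) : Type := EuclideanSpace ℂ (Fin n × Fin 2)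

/-- `ℂ⁴ⁿ = ℂ²ⁿ ⊕ ℂ²ⁿ`. -/
abbrev C4n (n : ℕ) : Type := Dbl (C2n n)

section Unbounded

variable {E : Type} [NormedAddCommGroup E] [InnerProductSpace ℂ E]

/-- `R` is the bounded, everywhere defined, two-sided inverse of `-T + z : dom T → E`. -/
def IsResolventAt (T : E →ₗ.[ℂ] E) (z : ℂ) (R : E →L[ℂ] E) : Prop :=
  (∀ x : E, ∃ h : R x ∈ T.domain, -T ⟨R x, h⟩ + z • R x = x) ∧
    ∀ x : T.domain, R (-T x + z • (x : E)) = x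

theorem IsResolventAt.unique {T : E →ₗ.[ℂ] E} {z : ℂ} {R R' : E →L[ℂ] E}
    (h : IsResolventAt T z R) (h' : IsResolventAt T z R') : R = R' := by
  ext x
  obtain ⟨hx, e⟩ := h'.1 x
  have := h.2 ⟨R' x, hx⟩
  rw [e] at this
  exact this

/-- The resolvent set `ϱ(T)`. -/
def resSet (T : E →ₗ.[ℂ] E) : Set ℂ := {z | ∃ R, IsResolventAt T z R}

open Classical in
/-- The resolvent `(-T + z)⁻¹`, for `z ∈ ϱ(T)`. -/
def resOp (T : E →ₗ.[ℂ] E) (z : ℂ) : E →L[ℂ] E :=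
  if h : ∃ R, IsResolventAt T z R then h.choose else 0

theorem resOp_spec {T : E →ₗ.[ℂ] E} {z : ℂ} (hz : z ∈ resSet T) :
    IsResolventAt T z (resOp T z) := by
  have hz' : ∃ R, IsResolventAt T z R := hz
  rw [resOp, dif_pos hz']
  exact hz'.choose_spec

/-- The defect space `ker(T* - z)`. -/
def defectSpace [CompleteSpace E] (T : E →ₗ.[ℂ] E) (z : ℂ) :
    Submodule ℂ T.adjoint.domain :=
  LinearMap.ker (T.adjoint.toFun - z • T.adjoint.domain.subtype)

/-- `T𝟙 = T ⊕ T` for an unbounded operator `T`. -/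
def dblPMap (T : E →ₗ.[ℂ] E) : Dbl E →ₗ.[ℂ] Dbl E where
  domain :=
    { carrier := {Ψ | ∀ j, Ψ j ∈ T.domain}
      add_mem' := fun ha hb j => T.domain.add_mem (ha j) (hb j)
      zero_mem' := fun _ => T.domain.zero_mem
      smul_mem' := fun c _ ha j => T.domain.smul_mem c (ha j) }
  toFun :=
    { toFun := fun Ψ => WithLp.toLp 2 fun j => T ⟨(Ψ : Dbl E) j, Ψ.2 j⟩
      map_add' := fun a b => by
        ext j
        exact T.map_add ⟨(a : Dbl E) j, a.2 j⟩ ⟨(b : Dbl E) j, b.2 j⟩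
      map_smul' := fun c a => by
        ext j
        exact T.map_smul c ⟨(a : Dbl E) j, a.2 j⟩ }

/-- `L𝟙 = L ⊕ L` for an arbitrary map `L`. -/
def dblFun {X Z : Type} (L : X → Z) (Ψ : Dbl X) : Dbl Z := WithLp.toLp 2 fun j => L (Ψ j)

end Unbounded

/-! ### Sobolev functions and traces -/

/-- `g ∈ L²(ℝ)` is the distributional derivative of `f ∈ L²(ℝ)` on the open set `U`. -/
def IsWeakDeriv (U : Set ℝ) (f g : L2R) : Prop :=
  ∀ φ : ℝ → ℝ, ContDiff ℝ ∞ φ → HasCompactSupport φ → tsupport φ ⊆ U →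
    ∫ x, deriv φ x • f x = -∫ x, φ x • g x

theorem integrable_test_smul (f : L2R) {φ : ℝ → ℝ} (hφ : Continuous φ)
    (hc : HasCompactSupport φ) : Integrable fun x => φ x • f x :=
  (((Lp.memLp f).locallyIntegrable (by norm_num)).integrable_smul_left_of_hasCompactSupport hφ hc)

theorem IsWeakDeriv.add {U : Set ℝ} {f f' g g' : L2R} (h : IsWeakDeriv U f g)
    (h' : IsWeakDeriv U f' g') : IsWeakDeriv U (f + f') (g + g') := by
  intro φ h1 h2 h3
  have hd : Continuous (deriv φ) := h1.continuous_deriv (by norm_cast)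
  have e1 : ∫ x, deriv φ x • (f + f') x = ∫ x, (deriv φ x • f x + deriv φ x • f' x) := by
    refine integral_congr_ae ?_
    filter_upwards [Lp.coeFn_add f f'] with x hx
    rw [hx, Pi.add_apply, smul_add]
  have e2 : ∫ x, φ x • (g + g') x = ∫ x, (φ x • g x + φ x • g' x) := by
    refine integral_congr_ae ?_
    filter_upwards [Lp.coeFn_add g g'] with x hx
    rw [hx, Pi.add_apply, smul_add]
  rw [e1, e2, integral_add (integrable_test_smul f hd h2.deriv)
    (integrable_test_smul f' hd h2.deriv), integral_add (integrable_test_smul g h1.continuous h2)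
    (integrable_test_smul g' h1.continuous h2), h φ h1 h2 h3, h' φ h1 h2 h3]
  ring

theorem IsWeakDeriv.smul {U : Set ℝ} {f g : L2R} (c : ℂ) (h : IsWeakDeriv U f g) :
    IsWeakDeriv U (c • f) (c • g) := by
  intro φ h1 h2 h3
  have e1 : ∫ x, deriv φ x • (c • f) x = ∫ x, c • (deriv φ x • f x) := by
    refine integral_congr_ae ?_
    filter_upwards [Lp.coeFn_smul c f] with x hx
    rw [hx, Pi.smul_apply, smul_comm]
  have e2 : ∫ x, φ x • (c • g) x = ∫ x, c • (φ x • g x) := by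
    refine integral_congr_ae ?_
    filter_upwards [Lp.coeFn_smul c g] with x hx
    rw [hx, Pi.smul_apply, smul_comm]
  rw [e1, e2, integral_smul, integral_smul, h φ h1 h2 h3, smul_neg]

theorem IsWeakDeriv.zero (U : Set ℝ) : IsWeakDeriv U 0 0 := by
  have h : ∀ ψ : ℝ → ℝ, ∫ x, ψ x • (0 : L2R) x = 0 := by
    intro ψ
    rw [← integral_zero ℝ ℂ (μ := volume)]
    refine integral_congr_ae ?_
    filter_upwards [Lp.coeFn_zero ℂ 2 (volume : Measure ℝ)] with x hx
    rw [hx, Pi.zero_apply, smul_zero]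
  intro φ _ _ _
  rw [h, h, neg_zero]

theorem IsWeakDeriv.unique {U : Set ℝ} (hU : IsOpen U) (hU' : volume Uᶜ = 0) {f g g' : L2R}
    (h : IsWeakDeriv U f g) (h' : IsWeakDeriv U f g') : g = g' := by
  have key : ∀ᵐ x ∂(volume : Measure ℝ), x ∈ U → (g - g') x = 0 := by
    refine hU.ae_eq_zero_of_integral_contDiff_smul_eq_zero
      (((Lp.memLp (g - g')).locallyIntegrable (by norm_num)).locallyIntegrableOn U) ?_
    intro φ h1 h2 h3
    have e : ∫ x, φ x • (g - g') x = ∫ x, (φ x • g x - φ x • g' x) := by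
      refine integral_congr_ae ?_
      filter_upwards [Lp.coeFn_sub g g'] with x hx
      rw [hx, Pi.sub_apply, smul_sub]
    rw [e, integral_sub (integrable_test_smul g h1.continuous h2)
      (integrable_test_smul g' h1.continuous h2)]
    have a := h φ h1 h2 h3
    have b := h' φ h1 h2 h3
    rw [a] at b
    rw [neg_injective b, sub_self]
  rw [← sub_eq_zero]
  refine Lp.ext ?_
  have hc : ∀ᵐ x ∂(volume : Measure ℝ), x ∈ U := by
    rw [ae_iff]
    exact hU'
  filter_upwards [key, hc, Lp.coeFn_zero ℂ 2 (volume : Measure ℝ)] with x hx hxU h0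
  rw [hx hxU, h0, Pi.zero_apply]

/-- `H²(U)`, for `U ⊆ ℝ` open with null complement: the functions in `L²` whose first and second
distributional derivatives on `U` are in `L²`. -/
def sobolevH2 (U : Set ℝ) : Submodule ℂ L2R where
  carrier := {f | ∃ g h, IsWeakDeriv U f g ∧ IsWeakDeriv U g h}
  add_mem' := by
    rintro _ _ ⟨g, h, a, b⟩ ⟨g', h', a', b'⟩
    exact ⟨g + g', h + h', a.add a', b.add b'⟩
  zero_mem' := ⟨0, 0, IsWeakDeriv.zero U, IsWeakDeriv.zero U⟩
  smul_mem' := by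
    rintro c _ ⟨g, h, a, b⟩
    exact ⟨c • g, c • h, a.smul c, b.smul c⟩

/-- The second distributional derivative of a function in `H²(ℝ)`. -/
def secondDeriv (f : sobolevH2 univ) : L2R := f.2.choose_spec.choose

theorem secondDeriv_eq (f : sobolevH2 univ) {g h : L2R} (hg : IsWeakDeriv univ (f : L2R) g)
    (hh : IsWeakDeriv univ g h) : secondDeriv f = h := by
  obtain ⟨a, b⟩ := f.2.choose_spec.choose_spec
  have hu : volume (univ : Set ℝ)ᶜ = 0 := by simp
  exact IsWeakDeriv.unique isOpen_univ hu ((IsWeakDeriv.unique isOpen_univ hu a hg) ▸ b) hh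

theorem secondDeriv_spec (f : sobolevH2 univ) :
    ∃ g, IsWeakDeriv univ (f : L2R) g ∧ IsWeakDeriv univ g (secondDeriv f) :=
  ⟨_, f.2.choose_spec.choose_spec⟩

/-- The free Schrödinger operator `H = -d²/dx²` in `L²(ℝ)`, with domain `H²(ℝ)`. -/
def freeH : L2R →ₗ.[ℂ] L2R where
  domain := sobolevH2 univ
  toFun :=
    { toFun := fun f => -secondDeriv f
      map_add' := fun f f' => by
        obtain ⟨g, a, b⟩ := secondDeriv_spec f
        obtain ⟨g', a', b'⟩ := secondDeriv_spec f'
        rw [secondDeriv_eq (f + f') (a.add a') (b.add b'), neg_add]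
      map_smul' := fun c f => by
        obtain ⟨g, a, b⟩ := secondDeriv_spec f
        rw [secondDeriv_eq (c • f) (a.smul c) (b.smul c), RingHom.id_apply, smul_neg] }

/-- The (essential) one-sided limits `f(t⁻)`, `f(t⁺)` exist and `a = ½ (f(t⁻) + f(t⁺))`. Limits are
taken along `ae`, so that they do not depend on the representative of `f` and agree with
the one-sided limits of a representative of `f` that is continuous on either side of `t`. -/
def HasMean (f : L2R) (t : ℝ) (a : ℂ) : Prop :=
  ∃ l r : ℂ, Tendsto f (𝓝[<] t ⊓ ae volume) (𝓝 l) ∧ Tendsto f (𝓝[>] t ⊓ ae volume) (𝓝 r) ∧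
    a = (l + r) / 2

theorem HasMean.add {f f' : L2R} {t : ℝ} {a a' : ℂ} (h : HasMean f t a) (h' : HasMean f' t a') :
    HasMean (f + f') t (a + a') := by
  obtain ⟨l, r, hl, hr, rfl⟩ := h
  obtain ⟨l', r', hl', hr', rfl⟩ := h'
  have e : (fun x => f x + f' x) =ᵐ[volume] (f + f' : L2R) := (Lp.coeFn_add f f').symm
  exact ⟨l + l', r + r', (hl.add hl').congr' (e.filter_mono inf_le_right),
    (hr.add hr').congr' (e.filter_mono inf_le_right), by ring⟩

theorem HasMean.smul {f : L2R} {t : ℝ} {a : ℂ} (c : ℂ) (h : HasMean f t a) :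
    HasMean (c • f) t (c * a) := by
  obtain ⟨l, r, hl, hr, rfl⟩ := h
  have e : (fun x => c * f x) =ᵐ[volume] (c • f : L2R) := (Lp.coeFn_smul c f).symm
  exact ⟨c * l, c * r, (hl.const_mul c).congr' (e.filter_mono inf_le_right),
    (hr.const_mul c).congr' (e.filter_mono inf_le_right), by ring⟩

theorem HasMean.zero (t : ℝ) : HasMean 0 t 0 := by
  have e : (fun _ => (0 : ℂ)) =ᵐ[volume] (0 : L2R) := (Lp.coeFn_zero ℂ 2 volume).symm
  exact ⟨0, 0, tendsto_const_nhds.congr' (e.filter_mono inf_le_right),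
    tendsto_const_nhds.congr' (e.filter_mono inf_le_right), by simp⟩

theorem neBot_left (t : ℝ) : (𝓝[<] t ⊓ ae (volume : Measure ℝ)).NeBot := by
  rw [inf_neBot_iff]
  intro s hs s' hs'
  obtain ⟨a, ha, has⟩ := mem_nhdsLT_iff_exists_Ioo_subset.1 hs
  by_contra hne
  have hsub : Ioo a t ⊆ s'ᶜ := fun x hx hx' => hne ⟨x, has hx, hx'⟩
  have h0 : volume (Ioo a t) = 0 := measure_mono_null hsub (mem_ae_iff.1 hs')
  rw [Real.volume_Ioo, ENNReal.ofReal_eq_zero] at h0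
  linarith [mem_Iio.1 ha]

theorem neBot_right (t : ℝ) : (𝓝[>] t ⊓ ae (volume : Measure ℝ)).NeBot := by
  rw [inf_neBot_iff]
  intro s hs s' hs'
  obtain ⟨a, ha, has⟩ := mem_nhdsGT_iff_exists_Ioo_subset.1 hs
  by_contra hne
  have hsub : Ioo t a ⊆ s'ᶜ := fun x hx hx' => hne ⟨x, has hx, hx'⟩
  have h0 : volume (Ioo t a) = 0 := measure_mono_null hsub (mem_ae_iff.1 hs')
  rw [Real.volume_Ioo, ENNReal.ofReal_eq_zero] at h0
  linarith [mem_Ioi.1 ha]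

theorem HasMean.unique {f : L2R} {t : ℝ} {a a' : ℂ} (h : HasMean f t a) (h' : HasMean f t a') :
    a = a' := by
  obtain ⟨l, r, hl, hr, rfl⟩ := h
  obtain ⟨l', r', hl', hr', rfl⟩ := h'
  have := neBot_left t
  have := neBot_right t
  rw [tendsto_nhds_unique hl hl', tendsto_nhds_unique hr hr']

variable {n : ℕ}

/-- `ℝ ∖ Y` with `Y = {y₁, …, yₙ}`. -/
def offY (y : Fin n → ℝ) : Set ℝ := (range y)ᶜ

/-- The graph of the trace `τ̂ : H²(ℝ∖Y) → ℂ²ⁿ`: the `k`-th block of `v` is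
`(⟨ψ⟩, ⟨ψ'⟩)` at `yₖ`, where `ψ'` is the distributional derivative on `ℝ∖Y`. -/
def HasTrace (y : Fin n → ℝ) (ψ : L2R) (v : C2n n) : Prop :=
  ∃ ψ' : L2R, IsWeakDeriv (offY y) ψ ψ' ∧
    ∀ k, HasMean ψ (y k) (v (k, 0)) ∧ HasMean ψ' (y k) (v (k, 1))

theorem HasTrace.unique {y : Fin n → ℝ} {ψ : L2R} {v w : C2n n} (h : HasTrace y ψ v)
    (h' : HasTrace y ψ w) : v = w := by
  obtain ⟨g, a, b⟩ := h
  obtain ⟨g', a', b'⟩ := h'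
  have hY : (range y).Finite := finite_range y
  have e : g = g' := IsWeakDeriv.unique hY.isClosed.isOpen_compl
    (by simpa [offY] using hY.measure_zero _) a a'
  subst e
  ext ⟨k, l⟩
  fin_cases l
  · exact (b k).1.unique (b' k).1
  · exact (b k).2.unique (b' k).2

open Classical in
/-- The trace `τ̂ψ` (every `ψ ∈ H²(ℝ∖Y)` has one; the value is `0` by convention on functions that
have none). -/
def traceHat (y : Fin n → ℝ) (ψ : L2R) : C2n n :=
  if h : ∃ v, HasTrace y ψ v then h.choose else 0

theorem HasTrace.trace_eq {y : Fin n → ℝ} {ψ : L2R} {v : C2n n} (h : HasTrace y ψ v) :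
    traceHat y ψ = v := by
  have h' : ∃ v, HasTrace y ψ v := ⟨v, h⟩
  rw [traceHat, dif_pos h']
  exact h'.choose_spec.unique h

/-- The kernel `{ψ ∈ H²(ℝ) : τ̂ψ = 0}` of the trace on `H²(ℝ)`. -/
def kerTrace (y : Fin n → ℝ) : Submodule ℂ L2R where
  carrier := {ψ | ψ ∈ sobolevH2 univ ∧ HasTrace y ψ 0}
  add_mem' := by
    rintro _ _ ⟨h, g, a, b⟩ ⟨h', g', a', b'⟩
    refine ⟨add_mem h h', g + g', a.add a', fun k => ⟨?_, ?_⟩⟩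
    · simpa using (b k).1.add (b' k).1
    · simpa using (b k).2.add (b' k).2
  zero_mem' := ⟨zero_mem _, 0, IsWeakDeriv.zero _, fun _ => ⟨HasMean.zero _, HasMean.zero _⟩⟩
  smul_mem' := by
    rintro c _ ⟨h, g, a, b⟩
    refine ⟨Submodule.smul_mem _ c h, c • g, a.smul c, fun k => ⟨?_, ?_⟩⟩
    · simpa using (b k).1.smul c
    · simpa using (b k).2.smul c

/-- The symmetric operator `Ŝ`: the restriction of `H` to `ker(τ̂|H²(ℝ))`. -/
def opS (y : Fin n → ℝ) : L2R →ₗ.[ℂ] L2R := freeH.domRestrict (kerTrace y)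

/-! ### The operators `Ĝ_z` -/

/-- The square root with positive imaginary part of `z ∈ ℂ ∖ [0, ∞)`. -/
def sqrtUp (z : ℂ) : ℂ := Complex.I * (-z) ^ (2⁻¹ : ℂ)

/-- The kernel `ĝ_z` of the free resolvent `(-H + z)⁻¹`. -/
def green (z : ℂ) (x : ℝ) : ℂ :=
  Complex.exp (Complex.I * sqrtUp z * (|x| : ℝ)) / (2 * Complex.I * sqrtUp z)

/-- The derivative `ĝ_z'` of `ĝ_z` (away from `x = 0`). -/
def greenDeriv (z : ℂ) (x : ℝ) : ℂ :=
  (SignType.sign x : ℂ) * Complex.exp (Complex.I * sqrtUp z * (|x| : ℝ)) / 2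

open Classical in
/-- The class in `L²(ℝ)` of a square integrable function (and `0` for other functions). -/
def toL2 (f : ℝ → ℂ) : L2R := if h : MemLp f 2 volume then h.toLp f else 0

/-- `[Ĝ_z ξ](x) = ∑ₖ (ĝ_z(yₖ - x) ξ_{k,1} + ĝ_z'(yₖ - x) ξ_{k,2})`, for `z ∈ ℂ ∖ [0, ∞)`. -/
def opG (y : Fin n → ℝ) (z : ℂ) : C2n n →L[ℂ] L2R :=
  LinearMap.toContinuousLinearMap
    { toFun := fun ξ => ∑ k, (ξ (k, 0) • toL2 (fun x => green z (y k - x)) +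
        ξ (k, 1) • toL2 (fun x => greenDeriv z (y k - x)))
      map_add' := fun ξ η => by
        rw [← Finset.sum_add_distrib]
        refine Finset.sum_congr rfl fun k _ => ?_
        simp only [PiLp.add_apply, add_smul]
        abel
      map_smul' := fun c ξ => by
        rw [RingHom.id_apply, Finset.smul_sum]
        refine Finset.sum_congr rfl fun k _ => ?_
        simp only [PiLp.smul_apply, smul_eq_mul, mul_smul, smul_add] }

/-! ### Parameters of the extensions -/

/-- A couple `(Π̂, Θ̂)`: an orthogonal projector in `ℂ⁴ⁿ` and a symmetric operator in its range. -/
structure Couple (n : ℕ) where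
  /-- The projector `Π̂`. -/
  proj : C4n n →ₗ[ℂ] C4n n
  isProj : proj.IsSymmetricProjection
  /-- The operator `Θ̂`. -/
  theta : LinearMap.range proj →ₗ[ℂ] LinearMap.range proj
  isSymm : ∀ ξ η : LinearMap.range proj,
    ⟪(theta ξ : C4n n), (η : C4n n)⟫_ℂ = ⟪(ξ : C4n n), (theta η : C4n n)⟫_ℂ

/-- `Θ̂ - Π̂ (τ̂ Ĝ_z 𝟙) Π̂ : ran Π̂ → ran Π̂`. -/
def Couple.gamma (p : Couple n) (y : Fin n → ℝ) (z : ℂ) (ξ : LinearMap.range p.proj) :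
    LinearMap.range p.proj :=
  p.theta ξ - p.proj.rangeRestrict (dblFun (traceHat y) (dblFun (opG y z) ξ))

end PointInteraction

end

open PointInteraction

/-!
The proof has an analytic part on the line and an abstract part on extensions of symmetric operators.

*Analysis.* A function in `L²(ℝ)` with a distributional derivative in `L²(ℝ)` is almost everywhere
equal to a primitive of it (`IsWeakDeriv.exists_isPrimitive`, from the du Bois-Reymond lemma), so
everything about `H²(ℝ)` reduces to integration by parts for primitives (`IsPrimitive.mul`,
`IsPrimitive.integral_Ioi`). It makes the free operator symmetric, and `-H + z` bounded below for
`z ∉ [0, ∞)`. It is onto there, as `f'' + z f = ψ` splits into the two first order equations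
`P' = i √z P + ψ` and `Q' = -i √z Q - ψ`, solved in `L²(ℝ)` by an energy estimate
(`exists_memLp_isPrimitive`); this determines the resolvent set (`resSet_freeH`). Integration by
parts on the two half-lines at `yₖ`, against the decaying exponentials, gives Green's representation
of `f(yₖ)` and `f'(yₖ)` by `f'' + z f`, which is the duality between `Ĝ_z` and `τ̂ (-H + z̄)⁻¹`
(`inner_opG`). The functions `Ĝ_z ξ` are explicit, and so are their traces (`hasTrace_opG`); their
matrix satisfies `(τ̂ Ĝ_z)* = τ̂ Ĝ_{z̄}` (`inner_traceG`). The trace maps `H²(ℝ)` onto `ℂ²ⁿ`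
(`exists_hasTrace`), and its kernel is dense (`dense_kerTrace`).

*Extensions.* These facts, doubled, form a `TraceData`, and the rest uses only them. The adjoint of
the restriction `S` has domain `dom A + ran G_z`. Its elements `Ψ = Ψ_z + G_z ξ` have a charge `ξ`,
which is independent of `z`, and a trace `τ Ψ`, and Green's identity
`⟪Ψ, S* Φ⟫ - ⟪S* Ψ, Φ⟫ = ⟪τ Ψ, η⟫ - ⟪ξ, τ Φ⟫` (`TraceData.green_identity`) says that the two form a
boundary triple. Hence the restrictions of `S*` that contain `S` correspond to linear relations
between charge and trace, with adjoints going to adjoints (`TraceData.adjoint_ext`), and the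
self-adjoint ones to relations equal to their adjoints. In finite dimension the latter are exactly
the relations `{(ξ, v) : ξ ∈ ran Π, Π v = Θ ξ}` of the couples (`relAdjoint_coupleRel`,
`exists_coupleRel_eq`). The resolvent formula comes from solving `Π τ Ψ = Θ ξ` for the charge.
-/

noncomputable section

namespace PointInteraction

/-! ### Primitives of locally integrable functions -/

/-- `u` is a primitive of the locally integrable function `u'`; in other words `u` is locally
absolutely continuous with almost everywhere derivative `u'`. -/
structure IsPrimitive (u u' : ℝ → ℂ) : Prop where
  locInt : LocallyIntegrable u'
  sub_eq : ∀ a b, u b - u a = ∫ x in a..b, u' x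

theorem intervalIntegrable_of_locallyIntegrable {u : ℝ → ℂ} (h : LocallyIntegrable u) (a b : ℝ) :
    IntervalIntegrable u volume a b :=
  (h.integrableOn_isCompact isCompact_uIcc).intervalIntegrable

theorem integrableOn_comp_neg {u : ℝ → ℂ} {a : ℝ} (hu : IntegrableOn u (Iic a)) :
    IntegrableOn (fun x => u (-x)) (Ioi (-a)) := by
  have := ((Measure.measurePreserving_neg (volume : Measure ℝ)).integrableOn_comp_preimage
    (Homeomorph.neg ℝ).measurableEmbedding (f := u) (s := Iic a)).2 hu
  rw [neg_preimage, Set.neg_Iic] at this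
  exact this.mono_set Ioi_subset_Ici_self

namespace IsPrimitive

variable {u u' v v' : ℝ → ℂ}

theorem intervalIntegrable (h : IsPrimitive u u') (a b : ℝ) : IntervalIntegrable u' volume a b :=
  intervalIntegrable_of_locallyIntegrable h.locInt a b

theorem continuous (h : IsPrimitive u u') : Continuous u := by
  have e : u = fun b => u 0 + ∫ x in (0 : ℝ)..b, u' x := by
    ext b
    rw [← h.sub_eq]
    ring
  rw [e]
  exact continuous_const.add (intervalIntegral.continuous_primitive h.intervalIntegrable 0)

theorem of_locallyIntegrable (h : LocallyIntegrable u') (c : ℂ) :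
    IsPrimitive (fun b => c + ∫ x in (0 : ℝ)..b, u' x) u' := by
  have hi := intervalIntegrable_of_locallyIntegrable h
  refine ⟨h, fun a b => ?_⟩
  rw [add_sub_add_left_eq_sub, intervalIntegral.integral_interval_sub_left (hi _ _) (hi _ _)]

theorem of_hasDerivAt (h : ∀ x, HasDerivAt u (u' x) x) (hc : Continuous u') :
    IsPrimitive u u' :=
  ⟨hc.locallyIntegrable, fun a b =>
    (intervalIntegral.integral_eq_sub_of_hasDerivAt (fun x _ => h x)
      (hc.intervalIntegrable a b)).symm⟩

theorem congr_deriv (h : IsPrimitive u u') (e : u' =ᵐ[volume] v') : IsPrimitive u v' :=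
  ⟨(locallyIntegrable_congr e).1 h.locInt, fun a b => by
    rw [h.sub_eq]
    exact intervalIntegral.integral_congr_ae (e.mono fun x hx _ => hx)⟩

theorem add (h : IsPrimitive u u') (h' : IsPrimitive v v') :
    IsPrimitive (fun x => u x + v x) (fun x => u' x + v' x) :=
  ⟨h.locInt.add h'.locInt, fun a b => by
    rw [intervalIntegral.integral_add (h.intervalIntegrable a b) (h'.intervalIntegrable a b),
      ← h.sub_eq, ← h'.sub_eq]
    ring⟩

theorem const_mul (c : ℂ) (h : IsPrimitive u u') :
    IsPrimitive (fun x => c * u x) (fun x => c * u' x) :=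
  ⟨h.locInt.smul c, fun a b => by
    rw [intervalIntegral.integral_const_mul, ← h.sub_eq]
    ring⟩

theorem conjugate (h : IsPrimitive u u') :
    IsPrimitive (fun x => conj (u x)) (fun x => conj (u' x)) := by
  refine ⟨?_, fun a b => ?_⟩
  · refine h.locInt.mono
      (Complex.continuous_conj.comp_aestronglyMeasurable h.locInt.aestronglyMeasurable)
      (Eventually.of_forall fun x => ?_)
    simp
  · rw [← map_sub, h.sub_eq]
    simp only [intervalIntegral, map_sub, integral_conj]

theorem comp_neg (h : IsPrimitive u u') :
    IsPrimitive (fun x => u (-x)) (fun x => -u' (-x)) := by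
  refine ⟨?_, fun a b => ?_⟩
  · have h1 : LocallyIntegrable (fun x => u' (-x)) := by
      rw [locallyIntegrable_iff]
      intro k hk
      have h2 := h.locInt.integrableOn_isCompact (hk.image continuous_neg)
      have e : (Neg.neg : ℝ → ℝ) ⁻¹' (Neg.neg '' k) = k :=
        preimage_image_eq k neg_injective
      have := ((Measure.measurePreserving_neg (volume : Measure ℝ)).integrableOn_comp_preimage
        (Homeomorph.neg ℝ).measurableEmbedding (f := u') (s := Neg.neg '' k)).2 h2
      rwa [e] at this
    exact h1.neg
  · rw [intervalIntegral.integral_neg, intervalIntegral.integral_comp_neg, ← h.sub_eq]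
    ring

/-- The product rule for primitives, by Fubini on the two triangles that make up the square
`[a, b]²`. -/
theorem mul (h : IsPrimitive u u') (h' : IsPrimitive v v') :
    IsPrimitive (fun x => u x * v x) (fun x => u' x * v x + u x * v' x) := by
  have i1 : LocallyIntegrable fun x => u' x * v x := by
    exact h.locInt.mul_continuous h'.continuous
  have i2 : LocallyIntegrable fun x => u x * v' x := by
    exact h'.locInt.continuous_mul h.continuous
  refine ⟨i1.add i2, ?_⟩
  have key : ∀ a b, a ≤ b → u b * v b - u a * v a = ∫ x in a..b, (u' x * v x + u x * v' x) := by
    intro a b hab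
    have j1 : IntegrableOn u' (Ioc a b) := (h.intervalIntegrable a b).1
    have j2 : IntegrableOn v' (Ioc a b) := (h'.intervalIntegrable a b).1
    have hT : MeasurableSet {p : ℝ × ℝ | p.2 ≤ p.1} := measurableSet_le measurable_snd measurable_fst
    have hF := (Integrable.mul_prod j1 j2).indicator hT
    have sw := integral_integral_swap (f := fun x t => {p : ℝ × ℝ | p.2 ≤ p.1}.indicator
      (fun p => u' p.1 * v' p.2) (x, t)) hF
    have e1 : ∫ x in Ioc a b, ∫ t in Ioc a b, {p : ℝ × ℝ | p.2 ≤ p.1}.indicator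
        (fun p => u' p.1 * v' p.2) (x, t) = ∫ x in Ioc a b, u' x * (v x - v a) := by
      refine setIntegral_congr_fun measurableSet_Ioc fun x hx => ?_
      have e : (fun t => {p : ℝ × ℝ | p.2 ≤ p.1}.indicator (fun p => u' p.1 * v' p.2) (x, t)) =
          (Iic x).indicator fun t => u' x * v' t := by
        ext t
        simp [indicator_apply]
      have e' : Ioc a b ∩ Iic x = Ioc a x := by
        ext t
        simp only [mem_inter_iff, mem_Ioc, mem_Iic]
        exact ⟨fun ht => ⟨ht.1.1, ht.2⟩, fun ht => ⟨⟨ht.1, ht.2.trans hx.2⟩, ht.2⟩⟩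
      simp only [e]
      rw [setIntegral_indicator measurableSet_Iic, e', integral_const_mul, h'.sub_eq a x,
        intervalIntegral.integral_of_le hx.1.le]
    have e2 : ∫ t in Ioc a b, ∫ x in Ioc a b, {p : ℝ × ℝ | p.2 ≤ p.1}.indicator
        (fun p => u' p.1 * v' p.2) (x, t) = ∫ t in Ioc a b, (u b - u t) * v' t := by
      refine setIntegral_congr_fun measurableSet_Ioc fun t ht => ?_
      have e : (fun x => {p : ℝ × ℝ | p.2 ≤ p.1}.indicator (fun p => u' p.1 * v' p.2) (x, t)) =
          (Ici t).indicator fun x => u' x * v' t := by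
        ext x
        simp [indicator_apply]
      have e' : Ioc a b ∩ Ici t = Icc t b := by
        ext x
        simp only [mem_inter_iff, mem_Ioc, mem_Icc, mem_Ici]
        exact ⟨fun hx => ⟨hx.2, hx.1.2⟩, fun hx => ⟨⟨ht.1.trans_le hx.1, hx.2⟩, hx.1⟩⟩
      simp only [e]
      rw [setIntegral_indicator measurableSet_Ici, e', integral_mul_const, h.sub_eq t b,
        integral_Icc_eq_integral_Ioc, intervalIntegral.integral_of_le ht.2]
    rw [e1, e2, ← intervalIntegral.integral_of_le hab, ← intervalIntegral.integral_of_le hab] at sw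
    have k1 := intervalIntegrable_of_locallyIntegrable i1 a b
    have k2 := intervalIntegrable_of_locallyIntegrable i2 a b
    have l1 : ∫ x in a..b, u' x * (v x - v a) = (∫ x in a..b, u' x * v x) - (u b - u a) * v a := by
      simp only [mul_sub]
      rw [intervalIntegral.integral_sub k1 ((h.intervalIntegrable a b).mul_const _),
        intervalIntegral.integral_mul_const, h.sub_eq]
    have l2 : ∫ x in a..b, (u b - u x) * v' x = u b * (v b - v a) - ∫ x in a..b, u x * v' x := by
      simp only [sub_mul]
      rw [intervalIntegral.integral_sub ((h'.intervalIntegrable a b).const_mul _) k2,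
        intervalIntegral.integral_const_mul, h'.sub_eq]
    rw [intervalIntegral.integral_add k1 k2]
    linear_combination -sw + l1 - l2
  intro a b
  rcases le_total a b with hab | hab
  · exact key a b hab
  · rw [intervalIntegral.integral_symm, ← key b a hab]
    ring

theorem tendsto_atTop (h : IsPrimitive u u') {a : ℝ} (hu' : IntegrableOn u' (Ioi a)) :
    Tendsto u atTop (𝓝 (u a + ∫ x in Ioi a, u' x)) := by
  have e : u = fun b => u a + ∫ x in a..b, u' x := by
    ext b
    rw [← h.sub_eq]
    ring
  have := (intervalIntegral_tendsto_integral_Ioi a hu' tendsto_id).const_add (u a)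
  rw [e]
  simpa using this

/-- An integrable function with an integrable derivative has limit zero at infinity. -/
theorem add_integral_Ioi_eq_zero (h : IsPrimitive u u') {a : ℝ} (hu : IntegrableOn u (Ioi a))
    (hu' : IntegrableOn u' (Ioi a)) : u a + ∫ x in Ioi a, u' x = 0 := by
  refine IntegrableAtFilter.eq_zero_of_tendsto (l := atTop) (μ := volume) (f := u)
    ⟨Ioi a, Ioi_mem_atTop a, hu⟩ (fun s hs => ?_) (h.tendsto_atTop hu')
  obtain ⟨b, hb⟩ := mem_atTop_sets.1 hs
  exact measure_mono_top (fun x hx => hb x hx) Real.volume_Ici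

theorem integral_Ioi (h : IsPrimitive u u') {a : ℝ} (hu : IntegrableOn u (Ioi a))
    (hu' : IntegrableOn u' (Ioi a)) : ∫ x in Ioi a, u' x = -u a := by
  linear_combination h.add_integral_Ioi_eq_zero hu hu'

theorem tendsto_atTop_zero (h : IsPrimitive u u') {a : ℝ} (hu : IntegrableOn u (Ioi a))
    (hu' : IntegrableOn u' (Ioi a)) : Tendsto u atTop (𝓝 0) :=
  h.add_integral_Ioi_eq_zero hu hu' ▸ h.tendsto_atTop hu'

theorem integral_Iic (h : IsPrimitive u u') {a : ℝ} (hu : IntegrableOn u (Iic a))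
    (hu' : IntegrableOn u' (Iic a)) : ∫ x in Iic a, u' x = u a := by
  have := h.comp_neg.integral_Ioi (integrableOn_comp_neg hu) (integrableOn_comp_neg hu').neg
  rw [integral_neg, integral_comp_neg_Ioi, neg_neg] at this
  exact neg_injective this

theorem tendsto_atBot_zero (h : IsPrimitive u u') {a : ℝ} (hu : IntegrableOn u (Iic a))
    (hu' : IntegrableOn u' (Iic a)) : Tendsto u atBot (𝓝 0) := by
  have := (h.comp_neg.tendsto_atTop_zero (integrableOn_comp_neg hu)
    (integrableOn_comp_neg hu').neg).comp tendsto_neg_atBot_atTop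
  simpa [Function.comp_def] using this

theorem integral_eq_zero (h : IsPrimitive u u') (hu : Integrable u) (hu' : Integrable u') :
    ∫ x, u' x = 0 := by
  rw [← intervalIntegral.integral_Iic_add_Ioi (b := 0) hu'.integrableOn hu'.integrableOn,
    h.integral_Iic hu.integrableOn hu'.integrableOn, h.integral_Ioi hu.integrableOn hu'.integrableOn,
    add_neg_cancel]

end IsPrimitive

/-! ### Distributional derivatives and primitives -/

/-- The du Bois-Reymond lemma: a function whose distributional derivative vanishes is constant.
A test function `χ` with integral zero is a derivative of a test function; in general
`χ - (∫ χ) φ₀` is one, for a fixed `φ₀` of integral one. -/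
theorem exists_ae_eq_const_of_integral_deriv_smul_eq_zero {u : ℝ → ℂ} (hu : LocallyIntegrable u)
    (h : ∀ φ : ℝ → ℝ, ContDiff ℝ ∞ φ → HasCompactSupport φ → ∫ x, deriv φ x • u x = 0) :
    ∃ c : ℂ, u =ᵐ[volume] fun _ => c := by
  obtain ⟨φ₀, s0, c0, i0⟩ : ∃ φ : ℝ → ℝ, ContDiff ℝ ∞ φ ∧ HasCompactSupport φ ∧ ∫ x, φ x = 1 := by
    let f : ContDiffBump (0 : ℝ) := ⟨1, 2, one_pos, one_lt_two⟩
    exact ⟨f.normed volume, f.contDiff_normed, f.hasCompactSupport_normed, f.integral_normed⟩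
  refine ⟨∫ x, φ₀ x • u x, ?_⟩
  set c := ∫ x, φ₀ x • u x with hc
  have key : ∀ᵐ x, u x - c = 0 := by
    refine ae_eq_zero_of_integral_contDiff_smul_eq_zero (hu.sub (locallyIntegrable_const c)) ?_
    intro χ sχ cχ
    have iχ : Integrable χ := sχ.continuous.integrable_of_hasCompactSupport cχ
    have iφ : Integrable φ₀ := s0.continuous.integrable_of_hasCompactSupport c0
    set ψ : ℝ → ℝ := fun x => χ x - (∫ x, χ x) * φ₀ x with hψ
    have sψ : ContDiff ℝ ∞ ψ := sχ.sub (contDiff_const.mul s0)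
    have cψ : HasCompactSupport ψ := cχ.sub c0.mul_left
    have iψ : ∫ x, ψ x = 0 := by
      rw [hψ, integral_sub iχ (iφ.const_mul _), integral_const_mul, i0]
      ring
    obtain ⟨R, hR⟩ := cψ.isCompact.isBounded.subset_closedBall 0
    have hR' : ∀ x, ψ x ≠ 0 → -(R + 1) < x ∧ x < R + 1 := fun x hx => by
      have := hR (subset_tsupport ψ hx)
      rw [Real.closedBall_eq_Icc, mem_Icc] at this
      constructor <;> linarith
    set φ : ℝ → ℝ := fun x => ∫ t in (-(R + 1))..x, ψ t with hφ
    have dφ : ∀ x, HasDerivAt φ (ψ x) x := fun x =>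
      intervalIntegral.integral_hasDerivAt_right (sψ.continuous.intervalIntegrable _ _)
        sψ.continuous.stronglyMeasurable.stronglyMeasurableAtFilter sψ.continuous.continuousAt
    have dφ' : deriv φ = ψ := funext fun x => (dφ x).deriv
    have sφ : ContDiff ℝ ∞ φ := by
      rw [contDiff_infty_iff_deriv]
      exact ⟨fun x => (dφ x).differentiableAt, dφ' ▸ sψ⟩
    have cφ : HasCompactSupport φ := by
      refine HasCompactSupport.intro (isCompact_Icc (a := -(R + 1)) (b := R + 1)) fun x hx => ?_
      rw [mem_Icc, not_and_or, not_le, not_le] at hx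
      rcases hx with hx | hx
      · refine intervalIntegral.integral_zero_ae (Eventually.of_forall fun t ht => ?_)
        rw [uIoc_of_ge hx.le] at ht
        by_contra h0
        exact absurd (hR' t h0).1 (not_lt.2 ht.2)
      · rw [hφ, ← iψ]
        exact intervalIntegral.integral_eq_integral_of_support_subset
          fun t ht => ⟨(hR' t ht).1, ((hR' t ht).2.trans hx).le⟩
    have e := h φ sφ cφ
    have j1 : Integrable fun x => χ x • u x :=
      hu.integrable_smul_left_of_hasCompactSupport sχ.continuous cχ
    have j2 : Integrable fun x => φ₀ x • u x :=
      hu.integrable_smul_left_of_hasCompactSupport s0.continuous c0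
    have e1 : ∫ x, ψ x • u x = (∫ x, χ x • u x) - (∫ x, χ x) • c := by
      have : ∀ x, ψ x • u x = χ x • u x - (∫ x, χ x) • (φ₀ x • u x) := fun x => by
        rw [hψ, sub_smul, mul_smul]
      simp only [this]
      have j3 : Integrable fun x => (∫ x, χ x) • (φ₀ x • u x) := j2.smul (∫ x, χ x)
      rw [integral_sub j1 j3, integral_smul]
    rw [dφ', e1] at e
    simp only [smul_sub]
    rw [integral_sub j1 (iχ.smul_const c), integral_smul_const, e]
  filter_upwards [key] with x hx using sub_eq_zero.1 hx

theorem locallyIntegrable_coeFn (f : L2R) : LocallyIntegrable f :=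
  (Lp.memLp f).locallyIntegrable (by norm_num)

theorem IsPrimitive.integral_deriv_smul {u u' : ℝ → ℂ} (h : IsPrimitive u u') {φ : ℝ → ℝ}
    (hφ : ContDiff ℝ ∞ φ) (hc : HasCompactSupport φ) :
    ∫ x, deriv φ x • u x = -∫ x, φ x • u' x := by
  have dφ : Continuous (deriv φ) := hφ.continuous_deriv (by norm_cast)
  have p : IsPrimitive (fun x => (φ x : ℂ)) (fun x => ((deriv φ x : ℝ) : ℂ)) :=
    IsPrimitive.of_hasDerivAt
      (fun x => (hφ.differentiable (by simp) x).hasDerivAt.ofReal_comp)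
      (Complex.continuous_ofReal.comp dφ)
  have i1 : Integrable fun x => deriv φ x • u x :=
    h.continuous.locallyIntegrable.integrable_smul_left_of_hasCompactSupport dφ hc.deriv
  have i2 : Integrable fun x => φ x • u' x :=
    h.locInt.integrable_smul_left_of_hasCompactSupport hφ.continuous hc
  have i3 : Integrable fun x => φ x • u x :=
    h.continuous.locallyIntegrable.integrable_smul_left_of_hasCompactSupport hφ.continuous hc
  have := (p.mul h).integral_eq_zero i3 (i1.add i2)
  simp only [← Complex.real_smul] at this
  rw [integral_add i1 i2] at this
  exact eq_neg_of_add_eq_zero_left this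

theorem IsPrimitive.isWeakDeriv {F F' : ℝ → ℂ} (h : IsPrimitive F F') {f g : L2R}
    (hf : f =ᵐ[volume] F) (hg : g =ᵐ[volume] F') : IsWeakDeriv univ f g := by
  intro φ h1 h2 _
  have e1 : ∫ x, deriv φ x • f x = ∫ x, deriv φ x • F x :=
    integral_congr_ae (hf.mono fun x hx => by simp only [hx])
  have e2 : ∫ x, φ x • g x = ∫ x, φ x • F' x :=
    integral_congr_ae (hg.mono fun x hx => by simp only [hx])
  rw [e1, e2, h.integral_deriv_smul h1 h2]

/-- A function with a locally integrable distributional derivative has a locally absolutely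
continuous representative. -/
theorem IsWeakDeriv.exists_isPrimitive {f g : L2R} (h : IsWeakDeriv univ f g) :
    ∃ F : ℝ → ℂ, f =ᵐ[volume] F ∧ IsPrimitive F g := by
  have p := IsPrimitive.of_locallyIntegrable (locallyIntegrable_coeFn g) 0
  have hp : LocallyIntegrable (fun b => 0 + ∫ x in (0 : ℝ)..b, g x) volume := p.continuous.locallyIntegrable
  obtain ⟨c, hc⟩ := exists_ae_eq_const_of_integral_deriv_smul_eq_zero
    ((locallyIntegrable_coeFn f).sub hp) (fun φ h1 h2 => by
      have dφ : Continuous (deriv φ) := h1.continuous_deriv (by norm_cast)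
      have i1 := integrable_test_smul f dφ h2.deriv
      have i2 := hp.integrable_smul_left_of_hasCompactSupport dφ h2.deriv
      simp only [Pi.sub_apply, smul_sub]
      rw [integral_sub i1 i2, p.integral_deriv_smul h1 h2, h φ h1 h2 (subset_univ _), sub_self])
  refine ⟨_, ?_, IsPrimitive.of_locallyIntegrable (locallyIntegrable_coeFn g) c⟩
  filter_upwards [hc] with x hx
  rw [Pi.sub_apply] at hx
  linear_combination hx

/-! ### The Sobolev space `H²(ℝ)` through locally absolutely continuous functions -/

/-- `F` is a `C¹` function with locally absolutely continuous derivative `F₁`, whose almost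
everywhere second derivative is `F₂`, and all three are square integrable. These are the good
representatives of the elements of `H²(ℝ)`. -/
structure IsH2 (F F₁ F₂ : ℝ → ℂ) : Prop where
  mem : MemLp F 2
  mem₁ : MemLp F₁ 2
  mem₂ : MemLp F₂ 2
  prim : IsPrimitive F F₁
  prim₁ : IsPrimitive F₁ F₂

theorem exists_isH2 (f : sobolevH2 univ) : ∃ (g : L2R) (F F₁ : ℝ → ℂ),
    IsH2 F F₁ (secondDeriv f) ∧ f =ᵐ[volume] F ∧ g =ᵐ[volume] F₁ ∧
      IsWeakDeriv univ (f : L2R) g := by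
  obtain ⟨g, hg, hh⟩ := secondDeriv_spec f
  obtain ⟨F, hF, pF⟩ := hg.exists_isPrimitive
  obtain ⟨F₁, hF₁, pF₁⟩ := hh.exists_isPrimitive
  exact ⟨g, F, F₁, ⟨(memLp_congr_ae hF).1 (Lp.memLp _), (memLp_congr_ae hF₁).1 (Lp.memLp _),
    Lp.memLp _, pF.congr_deriv hF₁, pF₁⟩, hF, hF₁, hg⟩

namespace IsH2

variable {F F₁ F₂ G G₁ G₂ : ℝ → ℂ}

theorem mem_sobolevH2 (h : IsH2 F F₁ F₂) {f : L2R} (hf : f =ᵐ[volume] F) :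
    ∃ hm : f ∈ sobolevH2 univ, secondDeriv ⟨f, hm⟩ =ᵐ[volume] F₂ := by
  have w1 := h.prim.isWeakDeriv hf h.mem₁.coeFn_toLp
  have w2 := h.prim₁.isWeakDeriv h.mem₁.coeFn_toLp h.mem₂.coeFn_toLp
  have hm : f ∈ sobolevH2 univ := ⟨_, _, w1, w2⟩
  refine ⟨hm, ?_⟩
  rw [secondDeriv_eq ⟨f, hm⟩ w1 w2]
  exact h.mem₂.coeFn_toLp

end IsH2

theorem integrable_mul_of_memLp {F G : ℝ → ℂ} {μ : Measure ℝ} (hF : MemLp F 2 μ)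
    (hG : MemLp G 2 μ) : Integrable (fun x => F x * G x) μ :=
  hF.integrable_mul hG

theorem memLp_conj {F : ℝ → ℂ} {μ : Measure ℝ} (hF : MemLp F 2 μ) :
    MemLp (fun x => conj (F x)) 2 μ :=
  hF.star

theorem inner_eq_integral {f g : L2R} {F G : ℝ → ℂ} (hf : f =ᵐ[volume] F)
    (hg : g =ᵐ[volume] G) : ⟪f, g⟫_ℂ = ∫ x, conj (F x) * G x := by
  rw [L2.inner_def]
  refine integral_congr_ae ?_
  filter_upwards [hf, hg] with x h1 h2
  rw [h1, h2, RCLike.inner_apply, mul_comm]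

/-- Integration by parts in `H²(ℝ)`. -/
theorem IsH2.integral_conj_mul {F F₁ F₂ G G₁ G₂ : ℝ → ℂ} (hF : IsH2 F F₁ F₂) (hG : IsH2 G G₁ G₂) :
    ∫ x, conj (F x) * G₂ x = -∫ x, conj (F₁ x) * G₁ x := by
  have i1 := integrable_mul_of_memLp (memLp_conj hF.mem) hG.mem₂
  have i2 := integrable_mul_of_memLp (memLp_conj hF.mem₁) hG.mem₁
  have := (hF.prim.conjugate.mul hG.prim₁).integral_eq_zero
    (integrable_mul_of_memLp (memLp_conj hF.mem) hG.mem₁) (i2.add i1)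
  rw [integral_add i2 i1] at this
  linear_combination this

/-! ### The free operator -/

theorem freeH_isFormalAdjoint : freeH.IsFormalAdjoint freeH := by
  intro f g
  obtain ⟨_, F, F₁, hF, fF, -, -⟩ := exists_isH2 f
  obtain ⟨_, G, G₁, hG, gG, -, -⟩ := exists_isH2 g
  change ⟪-secondDeriv f, (g : L2R)⟫_ℂ = ⟪(f : L2R), -secondDeriv g⟫_ℂ
  rw [inner_neg_left, inner_neg_right, ← inner_conj_symm, inner_eq_integral fF (ae_eq_refl _),
    inner_eq_integral gG (ae_eq_refl _), hF.integral_conj_mul hG, hG.integral_conj_mul hF,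
    map_neg, ← integral_conj]
  congr 3
  ext x
  simp [mul_comm]

theorem exists_inner_secondDeriv (f : sobolevH2 univ) :
    ∃ r : ℝ, 0 ≤ r ∧ ⟪(f : L2R), secondDeriv f⟫_ℂ = -(r : ℂ) := by
  obtain ⟨_, F, F₁, hF, fF, -, -⟩ := exists_isH2 f
  refine ⟨∫ x, ‖F₁ x‖ ^ 2, integral_nonneg fun x => by positivity, ?_⟩
  rw [inner_eq_integral fF (ae_eq_refl _), hF.integral_conj_mul hF, ← integral_complex_ofReal]
  congr 2
  ext x
  rw [← Complex.normSq_eq_conj_mul_self, Complex.normSq_eq_norm_sq]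

/-- `-H + z` is bounded below for `z ∉ [0, ∞)`, as `H` is symmetric and nonnegative. -/
theorem exists_freeH_lower_bound {z : ℂ} (hz : ¬ ∃ t : ℝ, 0 ≤ t ∧ z = t) :
    ∃ c : ℝ, 0 < c ∧ ∀ f : freeH.domain, c * ‖(f : L2R)‖ ≤ ‖-freeH f + z • (f : L2R)‖ := by
  obtain ⟨c, hc, key⟩ : ∃ c : ℝ, 0 < c ∧ ∀ r t : ℝ, 0 ≤ r → 0 ≤ t → c * t ≤ ‖-(r : ℂ) + z * t‖ := by
    by_cases him : z.im = 0
    · have hre : z.re < 0 := by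
        by_contra h
        exact hz ⟨z.re, not_lt.1 h, Complex.ext (by simp) (by simpa using him)⟩
      refine ⟨-z.re, by linarith, fun r t hr ht => ?_⟩
      refine le_trans ?_ (Complex.abs_re_le_norm _)
      refine le_trans ?_ (neg_le_abs _)
      simp [him]
      linarith
    · refine ⟨|z.im|, abs_pos.2 him, fun r t hr ht => ?_⟩
      refine le_trans ?_ (Complex.abs_im_le_norm _)
      simp [abs_mul, abs_of_nonneg ht]
  refine ⟨c, hc, fun f => ?_⟩
  obtain ⟨r, hr, e⟩ := exists_inner_secondDeriv f
  have e1 : ⟪(f : L2R), -freeH f + z • (f : L2R)⟫_ℂ = -(r : ℂ) + z * ((‖(f : L2R)‖ ^ 2 : ℝ) : ℂ) := by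
    change ⟪(f : L2R), -(-secondDeriv f) + z • (f : L2R)⟫_ℂ = _
    rw [neg_neg, inner_add_right, e, inner_smul_right, inner_self_eq_norm_sq_to_K]
    push_cast
    rfl
  have h1 := key r (‖(f : L2R)‖ ^ 2) hr (by positivity)
  rw [← e1] at h1
  have h2 := h1.trans (norm_inner_le_norm _ _)
  rcases (norm_nonneg (f : L2R)).eq_or_lt with h0 | h0
  · rw [← h0]
    simp
  · refine le_of_mul_le_mul_left ?_ h0
    linarith [h2, sq (‖(f : L2R)‖)]

/-! ### The square root -/

theorem sqrtUp_sq (z : ℂ) : sqrtUp z ^ 2 = z := by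
  have h : ((-z) ^ (2⁻¹ : ℂ)) ^ 2 = -z := by simp
  rw [sqrtUp, mul_pow, h, Complex.I_sq]
  ring

theorem sqrtUp_im_pos {z : ℂ} (hz : ¬ ∃ t : ℝ, 0 ≤ t ∧ z = t) : 0 < (sqrtUp z).im := by
  have h : z.re < ‖z‖ := by
    refine lt_of_le_of_ne (Complex.re_le_norm z) fun h => hz ⟨z.re, ?_, ?_⟩
    · rw [h]
      positivity
    · rw [Complex.re_eq_norm] at h
      exact (Complex.eq_re_of_ofReal_le h)
  rw [sqrtUp, Complex.I_mul_im, Complex.cpow_inv_two_re]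
  refine Real.sqrt_pos.2 ?_
  rw [norm_neg, Complex.neg_re]
  linarith

theorem sqrtUp_ne_zero {z : ℂ} (hz : ¬ ∃ t : ℝ, 0 ≤ t ∧ z = t) : sqrtUp z ≠ 0 := fun h => by
  have := sqrtUp_im_pos hz
  simp [h] at this

theorem sqrtUp_conj {z : ℂ} (hz : ¬ ∃ t : ℝ, 0 ≤ t ∧ z = t) :
    sqrtUp (conj z) = -conj (sqrtUp z) := by
  have h : Complex.arg (-z) ≠ Real.pi := fun h => by
    rw [Complex.arg_eq_pi_iff] at h
    simp only [Complex.neg_re, Complex.neg_im] at h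
    exact hz ⟨z.re, by linarith, Complex.ext (by simp) (by simpa using h.2)⟩
  rw [sqrtUp, sqrtUp, map_mul, Complex.conj_I, ← map_neg, Complex.conj_cpow _ _ h,
    map_inv₀, map_ofNat]
  simp

theorem conj_notMem {z : ℂ} (hz : ¬ ∃ t : ℝ, 0 ≤ t ∧ z = t) :
    ¬ ∃ t : ℝ, 0 ≤ t ∧ conj z = t := fun ⟨t, ht, e⟩ =>
  hz ⟨t, ht, by rw [← Complex.conj_conj z, e, Complex.conj_ofReal]⟩

/-! ### Solving the resolvent equation -/

section Unbounded

variable {E : Type} [NormedAddCommGroup E] [InnerProductSpace ℂ E]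

theorem mem_resSet_of_surjective {T : E →ₗ.[ℂ] E} {z : ℂ} {c : ℝ} (hc : 0 < c)
    (hb : ∀ f : T.domain, c * ‖(f : E)‖ ≤ ‖-T f + z • (f : E)‖)
    (hs : ∀ x, ∃ f : T.domain, -T f + z • (f : E) = x) : z ∈ resSet T := by
  let L : T.domain →ₗ[ℂ] E := -T.toFun + z • T.domain.subtype
  have hL : ∀ f, L f = -T f + z • (f : E) := fun f => rfl
  have hinj : Function.Injective L := by
    rw [injective_iff_map_eq_zero]
    intro f hf
    have := hb f
    rw [← hL, hf, norm_zero] at this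
    have h0 : ‖(f : E)‖ ≤ 0 := by
      by_contra h
      nlinarith [mul_pos hc (not_le.1 h)]
    exact Subtype.ext (norm_le_zero_iff.1 h0)
  let e := LinearEquiv.ofBijective L ⟨hinj, hs⟩
  have he : ∀ x, L (e.symm x) = x := fun x => e.apply_symm_apply x
  refine ⟨(T.domain.subtype ∘ₗ (e.symm : E →ₗ[ℂ] T.domain)).mkContinuous c⁻¹ fun x => ?_, ?_, ?_⟩
  · have := hb (e.symm x)
    rw [← hL, he] at this
    rw [inv_mul_eq_div, le_div_iff₀ hc, mul_comm]
    exact this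
  · exact fun x => ⟨(e.symm x).2, he x⟩
  · exact fun x => congrArg Subtype.val (e.symm_apply_apply x)

end Unbounded

theorem isPrimitive_cexp (w : ℂ) : IsPrimitive (fun x : ℝ => Complex.exp (w * x))
    (fun x : ℝ => w * Complex.exp (w * x)) := by
  refine IsPrimitive.of_hasDerivAt (fun x => ?_) (by fun_prop)
  have h1 : HasDerivAt (fun x : ℝ => w * (x : ℂ)) (w * 1) x :=
    (Complex.ofRealCLM.hasDerivAt (x := x)).const_mul w
  simpa [mul_comm] using h1.cexp

/-- The first order equation `P' = i s P + ψ` has a solution in `L²(ℝ)` when `Im s > 0`, namely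
`P(x) = ∫_{t < x} exp(i s (x - t)) ψ(t) dt`. With `κ = Im s`, the energy inequality
`(|P|²)' ≤ -κ |P|² + |ψ|² / κ` and the boundedness of `P` show that `P` is square integrable. -/
theorem exists_memLp_isPrimitive {s : ℂ} (hs : 0 < s.im) {ψ : ℝ → ℂ} (hψ : MemLp ψ 2) :
    ∃ P, MemLp P 2 ∧ IsPrimitive P (fun x => Complex.I * s * P x + ψ x) := by
  set κ := s.im with hκ
  have hψ2 : Integrable fun x => ‖ψ x‖ ^ 2 :=
    (memLp_two_iff_integrable_sq_norm hψ.1).1 hψ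
  set A := ∫ x, ‖ψ x‖ ^ 2 with hA
  have nexp : ∀ (w : ℂ) (x : ℝ), ‖Complex.exp (w * x)‖ = Real.exp (w.re * x) := fun w x => by
    rw [Complex.norm_exp]
    simp
  have hre : (Complex.I * s).re = -κ := by simp [hκ]
  have hre' : (-(Complex.I * s)).re = κ := by simp [hκ]
  -- the integrand is square integrable against a decaying exponential on each left half-line
  have bnd : ∀ x t : ℝ, ‖Complex.exp (Complex.I * s * x)‖ *
      ‖Complex.exp (-(Complex.I * s) * t) * ψ t‖ ≤
        (Real.exp (2 * κ * t) * Real.exp (-(2 * κ * x)) + ‖ψ t‖ ^ 2) / 2 := fun x t => by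
    rw [norm_mul, nexp, nexp, hre, hre', ← mul_assoc, ← Real.exp_add, ← Real.exp_add]
    have e : Real.exp (2 * κ * t + -(2 * κ * x)) = Real.exp (-κ * x + κ * t) ^ 2 := by
      rw [← Real.exp_nat_mul]
      congr 1
      push_cast
      ring
    rw [e]
    linarith [two_mul_le_add_sq (Real.exp (-κ * x + κ * t)) ‖ψ t‖]
  have ibnd : ∀ x : ℝ, IntegrableOn (fun t => (Real.exp (2 * κ * t) * Real.exp (-(2 * κ * x)) +
      ‖ψ t‖ ^ 2) / 2) (Iic x) := fun x =>
    (((integrableOn_exp_mul_Iic (by positivity) x).mul_const _).add hψ2.integrableOn).div_const 2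
  have locN : LocallyIntegrable fun t : ℝ => Complex.exp (-(Complex.I * s) * t) * ψ t :=
    (hψ.locallyIntegrable (by norm_num)).continuous_mul (isPrimitive_cexp _).continuous
  have intN : ∀ x : ℝ, IntegrableOn (fun t : ℝ => Complex.exp (-(Complex.I * s) * t) * ψ t) (Iic x) := by
    intro x
    refine ((ibnd x).const_mul (‖Complex.exp (Complex.I * s * x)‖⁻¹)).mono'
      locN.aestronglyMeasurable.restrict (Eventually.of_forall fun t => ?_)
    rw [← div_eq_inv_mul, le_div_iff₀ (norm_pos_iff.2 (Complex.exp_ne_zero _)), mul_comm]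
    exact bnd x t
  set N : ℝ → ℂ := fun x => ∫ t in Iic x, Complex.exp (-(Complex.I * s) * t) * ψ t with hN
  have pN : IsPrimitive N fun t => Complex.exp (-(Complex.I * s) * t) * ψ t :=
    ⟨locN, fun a b => intervalIntegral.integral_Iic_sub_Iic (intN a) (intN b)⟩
  set P : ℝ → ℂ := fun x => Complex.exp (Complex.I * s * x) * N x with hP
  have pP : IsPrimitive P fun x => Complex.I * s * P x + ψ x := by
    refine ((isPrimitive_cexp (Complex.I * s)).mul pN).congr_deriv (Eventually.of_forall fun x => ?_)
    have : Complex.exp (Complex.I * s * x) * Complex.exp (-(Complex.I * s) * x) = 1 := by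
      rw [← Complex.exp_add]
      simp
    simp only [hP]
    linear_combination ψ x * this
  have bP : ∀ x, ‖P x‖ ≤ ((2 * κ)⁻¹ + A) / 2 := fun x => by
    rw [hP, norm_mul]
    refine (mul_le_mul_of_nonneg_left (norm_integral_le_integral_norm _) (norm_nonneg _)).trans ?_
    rw [← integral_const_mul]
    refine (integral_mono ((intN x).norm.const_mul _) (ibnd x) (bnd x)).trans ?_
    rw [integral_div, integral_add ((integrableOn_exp_mul_Iic (by positivity) x).mul_const _)
      hψ2.integrableOn, integral_mul_const, integral_exp_mul_Iic (by positivity), div_mul_eq_mul_div,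
      ← Real.exp_add, add_neg_cancel, Real.exp_zero, one_div]
    gcongr
    exact setIntegral_le_integral hψ2 (Eventually.of_forall fun t => by positivity)
  refine ⟨P, ?_, pP⟩
  rw [memLp_two_iff_integrable_sq_norm pP.continuous.aestronglyMeasurable]
  have cP : Continuous fun x => ‖P x‖ ^ 2 := by
    have := pP.continuous
    fun_prop
  set M := ((2 * κ)⁻¹ + A) / 2 with hM
  refine integrable_of_intervalIntegral_norm_bounded (κ⁻¹ * (M ^ 2 + κ⁻¹ * A)) (l := atTop)
    (a := fun i : ℕ => -(i : ℝ)) (b := fun i : ℕ => (i : ℝ)) (fun i => ?_)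
    (tendsto_neg_atTop_atBot.comp tendsto_natCast_atTop_atTop) tendsto_natCast_atTop_atTop
    (Eventually.of_forall fun i => ?_)
  · exact (cP.intervalIntegrable _ _).1
  set a := -(i : ℝ)
  set b := (i : ℝ)
  have hab : a ≤ b := neg_le_self (Nat.cast_nonneg i)
  have pW := pP.mul pP.conjugate
  have e1 := congrArg Complex.re (pW.sub_eq a b)
  have e2 : (∫ x in a..b, ((Complex.I * s * P x + ψ x) * conj (P x) +
      P x * conj (Complex.I * s * P x + ψ x))).re ≤
        ∫ x in a..b, (-κ * ‖P x‖ ^ 2 + κ⁻¹ * ‖ψ x‖ ^ 2) := by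
    have := (Complex.reCLM.intervalIntegral_comp_comm (pW.intervalIntegrable a b)).symm
    rw [Complex.reCLM_apply] at this
    rw [this]
    refine intervalIntegral.integral_mono_on hab ?_ ?_ fun x _ => ?_
    · exact ⟨(pW.intervalIntegrable a b).1.re, (pW.intervalIntegrable a b).2.re⟩
    · exact ((cP.intervalIntegrable _ _).const_mul _).add (hψ2.intervalIntegrable.const_mul _)
    · have n1 : ‖P x‖ ^ 2 = (P x).re ^ 2 + (P x).im ^ 2 := by
        rw [← Complex.normSq_eq_norm_sq, Complex.normSq_apply]; ring
      have n2 : ‖ψ x‖ ^ 2 = (ψ x).re ^ 2 + (ψ x).im ^ 2 := by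
        rw [← Complex.normSq_eq_norm_sq, Complex.normSq_apply]; ring
      have q : ∀ p r : ℝ, 2 * p * r ≤ κ * p ^ 2 + κ⁻¹ * r ^ 2 := fun p r => by
        have h0 : 0 ≤ κ⁻¹ * (κ * p - r) ^ 2 := by positivity
        have h1 : κ⁻¹ * (κ * p - r) ^ 2 = κ * p ^ 2 - 2 * p * r + κ⁻¹ * r ^ 2 := by
          field_simp
          ring
        linarith
      have := q (P x).re (ψ x).re
      have := q (P x).im (ψ x).im
      rw [n1, n2]
      simp [-map_add, ← hκ]
      nlinarith
  rw [intervalIntegral.integral_add ((cP.intervalIntegrable _ _).const_mul _)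
    (hψ2.intervalIntegrable.const_mul _), intervalIntegral.integral_const_mul,
    intervalIntegral.integral_const_mul, ← e1, Complex.sub_re, Complex.mul_conj, Complex.mul_conj,
    Complex.ofReal_re, Complex.ofReal_re, Complex.normSq_eq_norm_sq, Complex.normSq_eq_norm_sq] at e2
  have e3 : ∫ x in a..b, ‖ψ x‖ ^ 2 ≤ A := by
    rw [intervalIntegral.integral_of_le hab]
    exact setIntegral_le_integral hψ2 (Eventually.of_forall fun t => by positivity)
  have e4 : ‖P a‖ ^ 2 ≤ M ^ 2 := pow_le_pow_left₀ (norm_nonneg _) (bP a) 2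
  have e5 : κ⁻¹ * ∫ x in a..b, ‖ψ x‖ ^ 2 ≤ κ⁻¹ * A := by gcongr
  simp only [norm_pow, norm_norm]
  rw [← div_eq_inv_mul, le_div_iff₀ hs]
  have : 0 ≤ ‖P b‖ ^ 2 := by positivity
  linarith

/-- The equation `f'' + z f = ψ` has a solution `f ∈ H²(ℝ)` for every `ψ ∈ L²(ℝ)`; with
`s² = z` it is a combination of the solutions of `P' = i s P + ψ` and `Q' = -i s Q - ψ`. -/
theorem exists_isH2_of_memLp {z : ℂ} (hz : ¬ ∃ t : ℝ, 0 ≤ t ∧ z = t) {ψ : ℝ → ℂ}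
    (hψ : MemLp ψ 2) : ∃ F F₁, IsH2 F F₁ (fun x => -z * F x + ψ x) := by
  have hs := sqrtUp_im_pos hz
  have hs0 := sqrtUp_ne_zero hz
  have hsq := sqrtUp_sq z
  set s := sqrtUp z
  obtain ⟨P, mP, pP⟩ := exists_memLp_isPrimitive hs hψ
  have hneg := Measure.measurePreserving_neg (volume : Measure ℝ)
  obtain ⟨Q', mQ', pQ'⟩ := exists_memLp_isPrimitive hs (hψ.comp_measurePreserving hneg)
  obtain ⟨Q, mQ, pQ⟩ : ∃ Q, MemLp Q 2 ∧ IsPrimitive Q (fun x => -(Complex.I * s * Q x + ψ x)) := by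
    refine ⟨_, mQ'.comp_measurePreserving hneg, ?_⟩
    simpa [Function.comp_def] using pQ'.comp_neg
  set c := (2 * (Complex.I * s))⁻¹ with hc
  have hI := Complex.I_sq
  have hc1 : c * (2 * (Complex.I * s)) = 1 :=
    inv_mul_cancel₀ (mul_ne_zero two_ne_zero (mul_ne_zero Complex.I_ne_zero hs0))
  have hF : MemLp (fun x => c * (P x + Q x)) 2 := (mP.add mQ).const_mul c
  refine ⟨fun x => c * (P x + Q x), fun x => 2⁻¹ * (P x + -1 * Q x), hF,
    (mP.add (mQ.const_mul (-1))).const_mul 2⁻¹, (hF.const_mul (-z)).add hψ, ?_, ?_⟩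
  · refine ((pP.add pQ).const_mul c).congr_deriv (Eventually.of_forall fun x => ?_)
    linear_combination (P x - Q x) / 2 * hc1
  · refine ((pP.add (pQ.const_mul (-1))).const_mul 2⁻¹).congr_deriv
      (Eventually.of_forall fun x => ?_)
    rw [← hsq]
    linear_combination (-(Complex.I * s) * (P x + Q x) / 2) * hc1 +
      c * (P x + Q x) * s ^ 2 * hI

theorem IsPrimitive.tendsto_zero_of_memLp {F F' : ℝ → ℂ} (h : IsPrimitive F F') (hF : MemLp F 2)
    (hF' : MemLp F' 2) : Tendsto F atTop (𝓝 0) ∧ Tendsto F atBot (𝓝 0) := by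
  have i1 := integrable_mul_of_memLp hF (memLp_conj hF)
  have i2 := (integrable_mul_of_memLp hF' (memLp_conj hF)).add
    (integrable_mul_of_memLp hF (memLp_conj hF'))
  have p := h.mul h.conjugate
  have key : ∀ l : Filter ℝ, Tendsto (fun x => F x * conj (F x)) l (𝓝 0) → Tendsto F l (𝓝 0) := by
    intro l hl
    rw [tendsto_zero_iff_norm_tendsto_zero] at hl ⊢
    have := hl.sqrt
    simpa [Real.sqrt_mul_self] using this
  exact ⟨key _ (p.tendsto_atTop_zero (a := 0) i1.integrableOn i2.integrableOn),
    key _ (p.tendsto_atBot_zero (a := 0) i1.integrableOn i2.integrableOn)⟩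

/-- For `t ≥ 0` no `f ∈ H²(ℝ)` solves `f'' + t f = exp(-i k x)` on `[0, 1]` and `f'' + t f = 0`
elsewhere, where `k² = t`: the integral of the left hand side against `exp(i k x)` vanishes. -/
theorem notMem_resSet_freeH {t : ℝ} (ht : 0 ≤ t) : (t : ℂ) ∉ resSet freeH := by
  rintro ⟨R, hR, -⟩
  set k : ℂ := Complex.I * (Real.sqrt t : ℝ) with hk
  have hk2 : k ^ 2 = -t := by
    rw [hk, mul_pow, Complex.I_sq, ← Complex.ofReal_pow, Real.sq_sqrt ht]
    ring
  have nk : ∀ x : ℝ, ‖Complex.exp (k * x)‖ = 1 := fun x => by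
    rw [Complex.norm_exp]
    simp [hk]
  set ψ : ℝ → ℂ := (Ioc 0 1).indicator fun x : ℝ => Complex.exp (-k * x) with hψ
  have mψ : MemLp ψ 2 := by
    rw [hψ, memLp_indicator_iff_restrict measurableSet_Ioc]
    refine MemLp.of_bound (by fun_prop) 1 (Eventually.of_forall fun x => ?_)
    rw [neg_mul, Complex.exp_neg, norm_inv, nk, inv_one]
  obtain ⟨hm, e⟩ := hR (mψ.toLp ψ)
  obtain ⟨_, F, F₁, hF, fF, -, -⟩ := exists_isH2 ⟨_, hm⟩
  change -(-secondDeriv ⟨_, hm⟩) + (t : ℂ) • R (mψ.toLp ψ) = _ at e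
  rw [neg_neg] at e
  have ae : ∀ᵐ x : ℝ, secondDeriv ⟨_, hm⟩ x + t * F x = ψ x := by
    filter_upwards [fF, mψ.coeFn_toLp, Lp.coeFn_add (secondDeriv ⟨_, hm⟩) ((t : ℂ) • R (mψ.toLp ψ)),
      Lp.coeFn_smul (t : ℂ) (R (mψ.toLp ψ))] with x h1 h2 h3 h4
    rw [e, h2, Pi.add_apply, h4, Pi.smul_apply, h1, smul_eq_mul] at h3
    exact h3.symm
  have p := ((isPrimitive_cexp k).mul hF.prim₁).add
    (((isPrimitive_cexp k).mul hF.prim).const_mul (-k))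
  set w := fun x : ℝ => Complex.exp (k * x) * F₁ x + -k * (Complex.exp (k * x) * F x) with hw
  have p' : IsPrimitive w ((Ioc 0 1).indicator fun _ => 1) := by
    refine p.congr_deriv ?_
    filter_upwards [ae] with x hx
    have e1 : Complex.exp (k * x) * ψ x = (Ioc 0 1).indicator (fun _ => 1) x := by
      by_cases h : x ∈ Ioc (0 : ℝ) 1
      · rw [hψ, indicator_of_mem h, indicator_of_mem h, ← Complex.exp_add]
        simp
      · rw [hψ, indicator_of_notMem h, indicator_of_notMem h, mul_zero]
    rw [← e1]
    linear_combination Complex.exp (k * x) * hx - Complex.exp (k * x) * F x * hk2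
  have hlim : ∀ l : Filter ℝ, Tendsto F l (𝓝 0) → Tendsto F₁ l (𝓝 0) → Tendsto w l (𝓝 0) := by
    intro l h1 h2
    have q : ∀ G : ℝ → ℂ, Tendsto G l (𝓝 0) →
        Tendsto (fun x : ℝ => Complex.exp (k * x) * G x) l (𝓝 0) := by
      intro G hG
      rw [tendsto_zero_iff_norm_tendsto_zero] at hG ⊢
      simpa [nk] using hG
    simpa only [mul_zero, add_zero] using (q _ h2).add ((q _ h1).const_mul (-k))
  obtain ⟨t1, b1⟩ := hF.prim.tendsto_zero_of_memLp hF.mem hF.mem₁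
  obtain ⟨t2, b2⟩ := hF.prim₁.tendsto_zero_of_memLp hF.mem₁ hF.mem₂
  have hi : Integrable ((Ioc (0 : ℝ) 1).indicator fun _ => (1 : ℂ)) :=
    (integrable_indicator_iff measurableSet_Ioc).2 (integrableOn_const (by simp))
  have lim1 := (hlim _ t1 t2).sub ((hlim _ b1 b2).comp tendsto_neg_atTop_atBot)
  have lim2 := intervalIntegral_tendsto_integral hi tendsto_neg_atTop_atBot tendsto_id
  have := tendsto_nhds_unique lim1 (lim2.congr fun x => (p'.sub_eq _ _).symm)
  rw [integral_indicator measurableSet_Ioc] at this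
  simp at this

theorem resSet_freeH : resSet freeH = {z : ℂ | ¬ ∃ t : ℝ, 0 ≤ t ∧ z = t} := by
  ext z
  constructor
  · rintro h ⟨t, ht, rfl⟩
    exact notMem_resSet_freeH ht h
  · intro hz
    obtain ⟨c, hc, hb⟩ := exists_freeH_lower_bound hz
    refine mem_resSet_of_surjective hc hb fun ψ => ?_
    obtain ⟨F, F₁, hF⟩ := exists_isH2_of_memLp hz (Lp.memLp ψ)
    obtain ⟨hm, e⟩ := hF.mem_sobolevH2 hF.mem.coeFn_toLp
    refine ⟨⟨_, hm⟩, ?_⟩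
    change -(-secondDeriv ⟨_, hm⟩) + z • hF.mem.toLp F = ψ
    rw [neg_neg]
    refine Lp.ext ?_
    filter_upwards [e, hF.mem.coeFn_toLp, Lp.coeFn_add (secondDeriv ⟨_, hm⟩) (z • hF.mem.toLp F),
      Lp.coeFn_smul z (hF.mem.toLp F)] with x h1 h2 h3 h4
    rw [h3, Pi.add_apply, h4, Pi.smul_apply, h1, h2, smul_eq_mul]
    ring

/-! ### Two-sided exponentials and Green's representation formula -/

theorem coeFn_toL2 {f : ℝ → ℂ} (h : MemLp f 2) : toL2 f =ᵐ[volume] f := by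
  rw [toL2, dif_pos h]
  exact h.coeFn_toLp

theorem toL2_congr {f g : ℝ → ℂ} (h : MemLp f 2) (e : f =ᵐ[volume] g) : toL2 f = toL2 g := by
  rw [toL2, dif_pos h, toL2, dif_pos ((memLp_congr_ae e).1 h)]
  exact (MemLp.toLp_eq_toLp_iff _ _).2 e

theorem memLp_ofReal {χ : ℝ → ℝ} (h : Continuous χ) (hc : HasCompactSupport χ) :
    MemLp (fun x => (χ x : ℂ)) 2 :=
  (Complex.continuous_ofReal.comp h).memLp_of_hasCompactSupport (hc.comp_left Complex.ofReal_zero)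

/-- The function `a exp(i s (y - x))` to the left of `y` and `b exp(i s (x - y))` to the right. -/
def twoSided (s : ℂ) (y : ℝ) (a b : ℂ) (x : ℝ) : ℂ :=
  if x ≤ y then a * Complex.exp (Complex.I * s * (y - x : ℝ))
  else b * Complex.exp (Complex.I * s * (x - y : ℝ))

section TwoSided

variable {s : ℂ} {y : ℝ}

theorem twoSided_of_le (a b : ℂ) {x : ℝ} (h : x ≤ y) :
    twoSided s y a b x = a * Complex.exp (Complex.I * s * (y - x : ℝ)) := if_pos h

theorem twoSided_of_lt (a b : ℂ) {x : ℝ} (h : y < x) :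
    twoSided s y a b x = b * Complex.exp (Complex.I * s * (x - y : ℝ)) := if_neg h.not_ge

theorem const_mul_twoSided (c a b : ℂ) (x : ℝ) :
    c * twoSided s y a b x = twoSided s y (c * a) (c * b) x := by
  rw [twoSided, twoSided]
  split_ifs <;> ring

theorem conj_twoSided (a b : ℂ) (x : ℝ) :
    conj (twoSided s y a b x) = twoSided (-conj s) y (conj a) (conj b) x := by
  rw [twoSided, twoSided]
  split_ifs <;> simp [← Complex.exp_conj]

/-- The left branch of `twoSided`, as a primitive of its derivative. -/
theorem isPrimitive_left (s : ℂ) (y : ℝ) (a : ℂ) :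
    IsPrimitive (fun x : ℝ => a * Complex.exp (Complex.I * s * (y - x : ℝ)))
      (fun x : ℝ => -(Complex.I * s * a) * Complex.exp (Complex.I * s * (y - x : ℝ))) := by
  have := (isPrimitive_cexp (-(Complex.I * s))).const_mul (a * Complex.exp (Complex.I * s * y))
  have e : ∀ x : ℝ, Complex.exp (Complex.I * s * (y - x : ℝ)) =
      Complex.exp (Complex.I * s * y) * Complex.exp (-(Complex.I * s) * x) := fun x => by
    rw [← Complex.exp_add]
    push_cast
    ring_nf
  simp only [e]
  convert this using 2 <;> ring

/-- The right branch of `twoSided`, as a primitive of its derivative. -/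
theorem isPrimitive_right (s : ℂ) (y : ℝ) (b : ℂ) :
    IsPrimitive (fun x : ℝ => b * Complex.exp (Complex.I * s * (x - y : ℝ)))
      (fun x : ℝ => Complex.I * s * b * Complex.exp (Complex.I * s * (x - y : ℝ))) := by
  have := (isPrimitive_left s (-y) b).comp_neg
  convert this using 2
  · congr 4
    ring
  · rw [neg_mul, neg_neg]
    congr 4
    ring

theorem memLp_left (hs : 0 < s.im) (a : ℂ) :
    MemLp (fun x : ℝ => a * Complex.exp (Complex.I * s * (y - x : ℝ))) 2
      (volume.restrict (Iic y)) := by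
  rw [memLp_two_iff_integrable_sq_norm
    (isPrimitive_left s y a).continuous.aestronglyMeasurable]
  have := ((integrableOn_exp_mul_Iic (a := 2 * s.im) (by positivity) y).const_mul
    (‖a‖ ^ 2 * Real.exp (-(2 * s.im * y))))
  refine this.congr (Eventually.of_forall fun x => ?_)
  simp only [norm_mul, mul_pow, Complex.norm_exp, ← Real.exp_nat_mul]
  rw [mul_assoc, ← Real.exp_add]
  congr 2
  simp
  ring

theorem memLp_right (hs : 0 < s.im) (b : ℂ) :
    MemLp (fun x : ℝ => b * Complex.exp (Complex.I * s * (x - y : ℝ))) 2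
      (volume.restrict (Ioi y)) := by
  rw [memLp_two_iff_integrable_sq_norm
    (isPrimitive_right s y b).continuous.aestronglyMeasurable]
  have := ((integrableOn_exp_mul_Ioi (a := -(2 * s.im)) (by linarith) y).const_mul
    (‖b‖ ^ 2 * Real.exp (2 * s.im * y)))
  refine this.congr (Eventually.of_forall fun x => ?_)
  simp only [norm_mul, mul_pow, Complex.norm_exp, ← Real.exp_nat_mul]
  rw [mul_assoc, ← Real.exp_add]
  congr 2
  simp
  ring

theorem memLp_twoSided (hs : 0 < s.im) (a b : ℂ) : MemLp (twoSided s y a b) 2 := by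
  have e : twoSided s y a b =
      (Iic y).piecewise (fun x : ℝ => a * Complex.exp (Complex.I * s * (y - x : ℝ)))
        (fun x : ℝ => b * Complex.exp (Complex.I * s * (x - y : ℝ))) := by
    ext x
    simp [twoSided, piecewise]
  rw [e]
  exact MemLp.piecewise measurableSet_Iic (memLp_left hs a) (by
    rw [compl_Iic]
    exact memLp_right hs b)

/-- Integration by parts against a two-sided exponential; the jump at `y` gives the boundary
term. -/
theorem integral_twoSided_mul (hs : 0 < s.im) (a b : ℂ) {G G' : ℝ → ℂ} (p : IsPrimitive G G')
    (hG : MemLp G 2) (hG' : MemLp G' 2) :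
    (∫ x, twoSided s y (-(Complex.I * s * a)) (Complex.I * s * b) x * G x) +
      ∫ x, twoSided s y a b x * G' x = (a - b) * G y := by
  have i1 := integrable_mul_of_memLp
    (memLp_twoSided (y := y) hs (-(Complex.I * s * a)) (Complex.I * s * b)) hG
  have i2 := integrable_mul_of_memLp (memLp_twoSided (y := y) hs a b) hG'
  have i3 : Integrable fun x => twoSided s y (-(Complex.I * s * a)) (Complex.I * s * b) x * G x +
      twoSided s y a b x * G' x := i1.add i2
  rw [← integral_add i1 i2, ← intervalIntegral.integral_Iic_add_Ioi (b := y)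
    i3.integrableOn i3.integrableOn]
  have l1 := ((isPrimitive_left s y a).mul p).integral_Iic (a := y)
    (integrable_mul_of_memLp (memLp_left hs a) (hG.restrict _))
    ((integrable_mul_of_memLp (memLp_left hs _) (hG.restrict _)).add
      (integrable_mul_of_memLp (memLp_left hs a) (hG'.restrict _)))
  have r1 := ((isPrimitive_right s y b).mul p).integral_Ioi (a := y)
    (integrable_mul_of_memLp (memLp_right hs b) (hG.restrict _))
    ((integrable_mul_of_memLp (memLp_right hs _) (hG.restrict _)).add
      (integrable_mul_of_memLp (memLp_right hs b) (hG'.restrict _)))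
  have l2 : ∫ x in Iic y, (twoSided s y (-(Complex.I * s * a)) (Complex.I * s * b) x * G x +
      twoSided s y a b x * G' x) = _ :=
    (setIntegral_congr_fun measurableSet_Iic fun x hx => by
      simp only [twoSided_of_le _ _ (mem_Iic.1 hx)]).trans l1
  have r2 : ∫ x in Ioi y, (twoSided s y (-(Complex.I * s * a)) (Complex.I * s * b) x * G x +
      twoSided s y a b x * G' x) = _ :=
    (setIntegral_congr_fun measurableSet_Ioi fun x hx => by
      simp only [twoSided_of_lt _ _ (mem_Ioi.1 hx)]).trans r1
  rw [l2, r2]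
  simp
  ring

/-- Green's representation formula: the boundary values of `F` at `y` are integrals of
`F'' + s² F` against two-sided exponentials. -/
theorem IsH2.integral_twoSided_mul {F F₁ F₂ : ℝ → ℂ} (hF : IsH2 F F₁ F₂) (hs : 0 < s.im)
    (a b : ℂ) : ∫ x, twoSided s y a b x * (F₂ x + s ^ 2 * F x) =
      (a - b) * F₁ y + Complex.I * s * (a + b) * F y := by
  have h1 := PointInteraction.integral_twoSided_mul (y := y) hs a b hF.prim₁ hF.mem₁ hF.mem₂
  have h2 := PointInteraction.integral_twoSided_mul (y := y) hs (-(Complex.I * s * a))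
    (Complex.I * s * b) hF.prim hF.mem hF.mem₁
  have e : ∀ x, twoSided s y (-(Complex.I * s * -(Complex.I * s * a)))
      (Complex.I * s * (Complex.I * s * b)) x * F x = -(twoSided s y a b x * (s ^ 2 * F x)) := by
    intro x
    have hI := Complex.I_sq
    have e1 : -(Complex.I * s * -(Complex.I * s * a)) = -s ^ 2 * a := by
      linear_combination s ^ 2 * a * hI
    have e2 : Complex.I * s * (Complex.I * s * b) = -s ^ 2 * b := by
      linear_combination s ^ 2 * b * hI
    rw [e1, e2, ← const_mul_twoSided]
    ring
  simp only [e] at h2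
  rw [integral_neg] at h2
  simp only [mul_add]
  rw [integral_add (integrable_mul_of_memLp (memLp_twoSided hs a b) hF.mem₂)
    (integrable_mul_of_memLp (memLp_twoSided hs a b) (hF.mem.const_mul (s ^ 2)))]
  linear_combination h1 - h2

theorem isWeakDeriv_twoSided (hs : 0 < s.im) (a b : ℂ) {U : Set ℝ} (hU : y ∉ U) :
    IsWeakDeriv U (toL2 (twoSided s y a b))
      (toL2 (twoSided s y (-(Complex.I * s * a)) (Complex.I * s * b))) := by
  intro φ h1 h2 h3
  have dφ : Continuous (deriv φ) := h1.continuous_deriv (by norm_cast)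
  have p : IsPrimitive (fun x => (φ x : ℂ)) (fun x => ((deriv φ x : ℝ) : ℂ)) :=
    IsPrimitive.of_hasDerivAt
      (fun x => (h1.differentiable (by simp) x).hasDerivAt.ofReal_comp)
      (Complex.continuous_ofReal.comp dφ)
  have key := integral_twoSided_mul (y := y) hs a b p (memLp_ofReal h1.continuous h2)
    (memLp_ofReal dφ h2.deriv)
  have h0 : φ y = 0 := image_eq_zero_of_notMem_tsupport fun h => hU (h3 h)
  rw [h0, Complex.ofReal_zero, mul_zero, add_comm] at key
  have e : ∀ (χ : ℝ → ℝ) (a b : ℂ), ∫ x, χ x • toL2 (twoSided s y a b) x =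
      ∫ x, twoSided s y a b x * χ x := fun χ a b => by
    refine integral_congr_ae ?_
    filter_upwards [coeFn_toL2 (memLp_twoSided (y := y) hs a b)] with x hx
    rw [hx, Complex.real_smul, mul_comm]
  rw [e, e]
  exact eq_neg_of_add_eq_zero_left key

end TwoSided

/-! ### The Green function and its traces -/

section Green

variable {z : ℂ}

theorem green_eq_twoSided (z : ℂ) (y x : ℝ) : green z (y - x) = twoSided (sqrtUp z) y
    (1 / (2 * Complex.I * sqrtUp z)) (1 / (2 * Complex.I * sqrtUp z)) x := by
  rcases le_or_gt x y with h | h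
  · rw [twoSided_of_le _ _ h, green, abs_of_nonneg (sub_nonneg.2 h)]
    ring
  · rw [twoSided_of_lt _ _ h, green, abs_of_neg (sub_neg.2 h), neg_sub]
    ring

theorem greenDeriv_of_lt (z : ℂ) {y x : ℝ} (h : x < y) : greenDeriv z (y - x) =
    1 / 2 * Complex.exp (Complex.I * sqrtUp z * (y - x : ℝ)) := by
  rw [greenDeriv, abs_of_pos (sub_pos.2 h), sign_pos (sub_pos.2 h)]
  simp
  ring

theorem greenDeriv_of_gt (z : ℂ) {y x : ℝ} (h : y < x) : greenDeriv z (y - x) =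
    -(1 / 2) * Complex.exp (Complex.I * sqrtUp z * (x - y : ℝ)) := by
  rw [greenDeriv, abs_of_neg (sub_neg.2 h), sign_neg (sub_neg.2 h), neg_sub]
  simp
  ring

theorem greenDeriv_ae_eq_twoSided (z : ℂ) (y : ℝ) : (fun x => greenDeriv z (y - x)) =ᵐ[volume]
    twoSided (sqrtUp z) y (1 / 2) (-(1 / 2)) := by
  filter_upwards [compl_mem_ae_iff.2 (measure_singleton y : volume {y} = 0)] with x hx
  rcases lt_or_gt_of_ne (show x ≠ y from hx) with h | h
  · rw [greenDeriv_of_lt z h, twoSided_of_le _ _ h.le]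
  · rw [greenDeriv_of_gt z h, twoSided_of_lt _ _ h]

theorem toL2_green (z : ℂ) (y : ℝ) :
    toL2 (fun x => green z (y - x)) = toL2 (twoSided (sqrtUp z) y
      (1 / (2 * Complex.I * sqrtUp z)) (1 / (2 * Complex.I * sqrtUp z))) :=
  congrArg toL2 (funext fun x => green_eq_twoSided z y x)

theorem toL2_greenDeriv (hz : ¬ ∃ t : ℝ, 0 ≤ t ∧ z = t) (y : ℝ) :
    toL2 (fun x => greenDeriv z (y - x)) = toL2 (twoSided (sqrtUp z) y (1 / 2) (-(1 / 2))) :=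
  (toL2_congr (memLp_twoSided (sqrtUp_im_pos hz) _ _) (greenDeriv_ae_eq_twoSided z y).symm).symm

theorem toL2_const_mul (c : ℂ) {f : ℝ → ℂ} (h : MemLp f 2) :
    toL2 (fun x => c * f x) = c • toL2 f := by
  refine Lp.ext ?_
  filter_upwards [coeFn_toL2 h, coeFn_toL2 (h.const_mul c), Lp.coeFn_smul c (toL2 f)] with x h1 h2 h3
  rw [h2, h3, Pi.smul_apply, h1, smul_eq_mul]

theorem isWeakDeriv_green (hz : ¬ ∃ t : ℝ, 0 ≤ t ∧ z = t) {y : ℝ} {U : Set ℝ} (hU : y ∉ U) :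
    IsWeakDeriv U (toL2 fun x => green z (y - x)) ((-1 : ℂ) • toL2 fun x => greenDeriv z (y - x)) := by
  have hs := sqrtUp_im_pos hz
  have hs0 := sqrtUp_ne_zero hz
  rw [toL2_green z, toL2_greenDeriv hz, ← toL2_const_mul _ (memLp_twoSided hs _ _)]
  convert isWeakDeriv_twoSided hs _ _ hU using 2
  ext x
  rw [const_mul_twoSided]
  have hI := Complex.I_ne_zero
  congr 1 <;> field_simp

theorem isWeakDeriv_greenDeriv (hz : ¬ ∃ t : ℝ, 0 ≤ t ∧ z = t) {y : ℝ} {U : Set ℝ} (hU : y ∉ U) :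
    IsWeakDeriv U (toL2 fun x => greenDeriv z (y - x)) (z • toL2 fun x => green z (y - x)) := by
  have hs := sqrtUp_im_pos hz
  have hs0 := sqrtUp_ne_zero hz
  have hsq := sqrtUp_sq z
  rw [toL2_green z, toL2_greenDeriv hz, ← toL2_const_mul _ (memLp_twoSided hs _ _)]
  convert isWeakDeriv_twoSided hs _ _ hU using 2
  ext x
  rw [const_mul_twoSided]
  have hI := Complex.I_ne_zero
  have hI2 := Complex.I_sq
  congr 1 <;> field_simp <;> linear_combination (-1 : ℂ) * hsq + sqrtUp z ^ 2 * hI2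

theorem hasMean_of_tendsto {f : L2R} {F : ℝ → ℂ} (hf : f =ᵐ[volume] F) {t : ℝ} {l r : ℂ}
    (hl : Tendsto F (𝓝[<] t) (𝓝 l)) (hr : Tendsto F (𝓝[>] t) (𝓝 r)) :
    HasMean f t ((l + r) / 2) := by
  have e : F =ᵐ[volume] f := hf.symm
  exact ⟨l, r, (hl.mono_left inf_le_left).congr' (e.filter_mono inf_le_right),
    (hr.mono_left inf_le_left).congr' (e.filter_mono inf_le_right), rfl⟩

theorem hasMean_of_continuousAt {f : L2R} {F : ℝ → ℂ} (hf : f =ᵐ[volume] F) {t : ℝ}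
    (h : ContinuousAt F t) : HasMean f t (F t) := by
  have := hasMean_of_tendsto hf (h.tendsto.mono_left nhdsWithin_le_nhds)
    (h.tendsto.mono_left nhdsWithin_le_nhds)
  rwa [add_self_div_two] at this

theorem hasMean_green (hz : ¬ ∃ t : ℝ, 0 ≤ t ∧ z = t) (y t : ℝ) :
    HasMean (toL2 fun x => green z (y - x)) t (green z (y - t)) := by
  have m : MemLp (fun x => green z (y - x)) 2 := by
    simp only [green_eq_twoSided]
    exact memLp_twoSided (sqrtUp_im_pos hz) _ _
  refine hasMean_of_continuousAt (coeFn_toL2 m) (Continuous.continuousAt ?_)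
  unfold green
  fun_prop

theorem hasMean_greenDeriv (hz : ¬ ∃ t : ℝ, 0 ≤ t ∧ z = t) (y t : ℝ) :
    HasMean (toL2 fun x => greenDeriv z (y - x)) t (greenDeriv z (y - t)) := by
  have m : MemLp (fun x => greenDeriv z (y - x)) 2 :=
    (memLp_congr_ae (greenDeriv_ae_eq_twoSided z y)).2 (memLp_twoSided (sqrtUp_im_pos hz) _ _)
  have cl : Continuous fun x : ℝ => 1 / 2 * Complex.exp (Complex.I * sqrtUp z * (y - x : ℝ)) := by
    fun_prop
  have cr : Continuous fun x : ℝ => -(1 / 2) * Complex.exp (Complex.I * sqrtUp z * (x - y : ℝ)) := by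
    fun_prop
  rcases lt_trichotomy t y with h | rfl | h
  · refine hasMean_of_continuousAt (coeFn_toL2 m) (cl.continuousAt.congr ?_)
    filter_upwards [Iio_mem_nhds h] with x hx using (greenDeriv_of_lt z hx).symm
  · have l1 := (cl.tendsto t).mono_left (nhdsWithin_le_nhds (s := Iio t))
    have r1 := (cr.tendsto t).mono_left (nhdsWithin_le_nhds (s := Ioi t))
    convert hasMean_of_tendsto (coeFn_toL2 m) (l1.congr' ?_) (r1.congr' ?_) using 1
    · simp [greenDeriv]
    · filter_upwards [self_mem_nhdsWithin] with x hx using (greenDeriv_of_lt z hx).symm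
    · filter_upwards [self_mem_nhdsWithin] with x hx using (greenDeriv_of_gt z hx).symm
  · refine hasMean_of_continuousAt (coeFn_toL2 m) (cr.continuousAt.congr ?_)
    filter_upwards [Ioi_mem_nhds h] with x hx using (greenDeriv_of_gt z hx).symm

theorem green_neg (z : ℂ) (x : ℝ) : green z (-x) = green z x := by
  simp [green]

theorem greenDeriv_neg (z : ℂ) (x : ℝ) : greenDeriv z (-x) = -greenDeriv z x := by
  rw [greenDeriv, greenDeriv, Left.sign_neg, abs_neg]
  push_cast
  ring

theorem green_conj (hz : ¬ ∃ t : ℝ, 0 ≤ t ∧ z = t) (x : ℝ) : green (conj z) x = conj (green z x) := by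
  have h2 : conj (2 : ℂ) = 2 := map_ofNat _ 2
  rw [green, green, sqrtUp_conj hz]
  simp [h2, ← Complex.exp_conj]

theorem greenDeriv_conj (hz : ¬ ∃ t : ℝ, 0 ≤ t ∧ z = t) (x : ℝ) :
    greenDeriv (conj z) x = conj (greenDeriv z x) := by
  have h2 : conj (2 : ℂ) = 2 := map_ofNat _ 2
  rw [greenDeriv, greenDeriv, sqrtUp_conj hz]
  rcases lt_trichotomy x 0 with h | h | h <;> simp [h2, ← Complex.exp_conj, h]

end Green

/-! ### Linearity of the trace -/

section Trace

variable {n : ℕ} {y : Fin n → ℝ}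

theorem HasTrace.add {ψ φ : L2R} {v w : C2n n} (h : HasTrace y ψ v) (h' : HasTrace y φ w) :
    HasTrace y (ψ + φ) (v + w) := by
  obtain ⟨g, a, b⟩ := h
  obtain ⟨g', a', b'⟩ := h'
  exact ⟨g + g', a.add a', fun k => ⟨(b k).1.add (b' k).1, (b k).2.add (b' k).2⟩⟩

theorem HasTrace.smul {ψ : L2R} {v : C2n n} (c : ℂ) (h : HasTrace y ψ v) :
    HasTrace y (c • ψ) (c • v) := by
  obtain ⟨g, a, b⟩ := h
  exact ⟨c • g, a.smul c, fun k => ⟨(b k).1.smul c, (b k).2.smul c⟩⟩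

theorem HasTrace.zero : HasTrace y 0 0 :=
  ⟨0, IsWeakDeriv.zero _, fun _ => ⟨HasMean.zero _, HasMean.zero _⟩⟩

theorem HasTrace.sum {ι : Type} (s : Finset ι) {ψ : ι → L2R} {v : ι → C2n n}
    (h : ∀ i, HasTrace y (ψ i) (v i)) : HasTrace y (∑ i ∈ s, ψ i) (∑ i ∈ s, v i) := by
  classical
  induction s using Finset.induction_on with
  | empty => simpa using HasTrace.zero
  | insert i s hi ih =>
    rw [Finset.sum_insert hi, Finset.sum_insert hi]
    exact (h i).add ih

/-- The functions that have a trace. -/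
def traceDomain (y : Fin n → ℝ) : Submodule ℂ L2R where
  carrier := {ψ | ∃ v, HasTrace y ψ v}
  add_mem' := fun ⟨_, h⟩ ⟨_, h'⟩ => ⟨_, h.add h'⟩
  zero_mem' := ⟨_, HasTrace.zero⟩
  smul_mem' := fun c _ ⟨_, h⟩ => ⟨_, h.smul c⟩

theorem hasTrace_traceHat {ψ : L2R} (h : ψ ∈ traceDomain y) : HasTrace y ψ (traceHat y ψ) := by
  obtain ⟨v, hv⟩ := h
  rwa [hv.trace_eq]

theorem IsWeakDeriv.mono {U V : Set ℝ} (h : U ⊆ V) {f g : L2R} (hfg : IsWeakDeriv V f g) :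
    IsWeakDeriv U f g := fun φ h1 h2 h3 => hfg φ h1 h2 (h3.trans h)

/-- The trace of an element of `H²(ℝ)` consists of point values of the good representatives. -/
theorem exists_isH2_hasTrace (y : Fin n → ℝ) (f : sobolevH2 univ) : ∃ F F₁ : ℝ → ℂ,
    IsH2 F F₁ (secondDeriv f) ∧ f =ᵐ[volume] F ∧
      HasTrace y f (WithLp.toLp 2 fun p => if p.2 = 0 then F (y p.1) else F₁ (y p.1)) := by
  obtain ⟨g, F, F₁, hF, hf, hg, w⟩ := exists_isH2 f
  refine ⟨F, F₁, hF, hf, g, w.mono (subset_univ _), fun k => ⟨?_, ?_⟩⟩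
  · exact hasMean_of_continuousAt hf hF.prim.continuous.continuousAt
  · exact hasMean_of_continuousAt hg hF.prim₁.continuous.continuousAt

theorem sobolevH2_le_traceDomain : sobolevH2 univ ≤ traceDomain y := fun f hf => by
  obtain ⟨F, F₁, -, -, h⟩ := exists_isH2_hasTrace y ⟨f, hf⟩
  exact ⟨_, h⟩

/-- The matrix of `τ̂ Ĝ_z`. -/
def traceG (y : Fin n → ℝ) (z : ℂ) (ξ : C2n n) : C2n n :=
  WithLp.toLp 2 fun p => ∑ k, if p.2 = 0 then
    ξ (k, 0) * green z (y k - y p.1) + ξ (k, 1) * greenDeriv z (y k - y p.1)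
    else ξ (k, 0) * -greenDeriv z (y k - y p.1) + ξ (k, 1) * (z * green z (y k - y p.1))

theorem opG_apply (y : Fin n → ℝ) (z : ℂ) (ξ : C2n n) : opG y z ξ =
    ∑ k, (ξ (k, 0) • toL2 (fun x => green z (y k - x)) +
        ξ (k, 1) • toL2 (fun x => greenDeriv z (y k - x))) := rfl

theorem hasTrace_opG {z : ℂ} (hz : ¬ ∃ t : ℝ, 0 ≤ t ∧ z = t) (ξ : C2n n) :
    HasTrace y (opG y z ξ) (traceG y z ξ) := by
  have hk : ∀ k, y k ∉ offY y := fun k h => h ⟨k, rfl⟩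
  have h1 : ∀ k, HasTrace y (toL2 fun x => green z (y k - x)) (WithLp.toLp 2 fun p =>
      if p.2 = 0 then green z (y k - y p.1) else -greenDeriv z (y k - y p.1)) := fun k =>
    ⟨_, isWeakDeriv_green hz (hk k), fun j => ⟨hasMean_green hz _ _, by
      simpa using (hasMean_greenDeriv hz (y k) (y j)).smul (-1)⟩⟩
  have h2 : ∀ k, HasTrace y (toL2 fun x => greenDeriv z (y k - x)) (WithLp.toLp 2 fun p =>
      if p.2 = 0 then greenDeriv z (y k - y p.1) else z * green z (y k - y p.1)) := fun k =>
    ⟨_, isWeakDeriv_greenDeriv hz (hk k), fun j => ⟨hasMean_greenDeriv hz _ _, by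
      simpa using (hasMean_green hz (y k) (y j)).smul z⟩⟩
  rw [opG_apply]
  convert HasTrace.sum Finset.univ fun k => ((h1 k).smul (ξ (k, 0))).add ((h2 k).smul (ξ (k, 1)))
  ext ⟨j, l⟩
  rw [traceG, WithLp.ofLp_sum, Finset.sum_apply]
  dsimp only
  refine Finset.sum_congr rfl fun k _ => ?_
  by_cases hl : l = 0 <;> simp [hl]

theorem inner_C2n (ξ η : C2n n) :
    ⟪ξ, η⟫_ℂ = ∑ k, (conj (ξ (k, 0)) * η (k, 0) + conj (ξ (k, 1)) * η (k, 1)) := by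
  rw [PiLp.inner_apply, Fintype.sum_prod_type]
  refine Finset.sum_congr rfl fun k _ => ?_
  rw [Fin.sum_univ_two, RCLike.inner_apply, RCLike.inner_apply, mul_comm, mul_comm (η (k, 1))]

theorem inner_traceG {z : ℂ} (hz : ¬ ∃ t : ℝ, 0 ≤ t ∧ z = t) (ξ η : C2n n) :
    ⟪traceG y z ξ, η⟫_ℂ = ⟪ξ, traceG y (conj z) η⟫_ℂ := by
  rw [inner_C2n, inner_C2n]
  simp only [traceG, if_pos, map_sum, Finset.sum_mul, Finset.mul_sum, one_ne_zero, if_false,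
    ← Finset.sum_add_distrib]
  rw [Finset.sum_comm]
  refine Finset.sum_congr rfl fun k _ => Finset.sum_congr rfl fun j _ => ?_
  rw [← neg_sub (y k) (y j), green_neg, greenDeriv_neg, green_conj hz, greenDeriv_conj hz]
  simp only [map_add, map_mul, map_neg]
  ring

/-- `Ĝ_z` is the adjoint of `τ̂ (-H + z̄)⁻¹`: Green's representation formula. -/
theorem inner_opG {z : ℂ} (hz : ¬ ∃ t : ℝ, 0 ≤ t ∧ z = t) (ξ : C2n n) (f : freeH.domain) :
    ⟪opG y z ξ, -freeH f + conj z • (f : L2R)⟫_ℂ = ⟪ξ, traceHat y f⟫_ℂ := by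
  have hs := sqrtUp_im_pos hz
  have hs0 := sqrtUp_ne_zero hz
  have hs' := sqrtUp_im_pos (conj_notMem hz)
  have hsq' := sqrtUp_sq (conj z)
  rw [sqrtUp_conj hz] at hs' hsq'
  obtain ⟨F, F₁, hF, hf, ht⟩ := exists_isH2_hasTrace y f
  have hψ : (-freeH f + conj z • (f : L2R) : L2R) =ᵐ[volume]
      fun x => secondDeriv f x + (-conj (sqrtUp z)) ^ 2 * F x := by
    change (-(-secondDeriv f) + conj z • (f : L2R) : L2R) =ᵐ[volume] _
    rw [neg_neg]
    filter_upwards [hf, Lp.coeFn_add (secondDeriv f) (conj z • (f : L2R)),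
      Lp.coeFn_smul (conj z) (f : L2R)] with x h1 h2 h3
    rw [h2, Pi.add_apply, h3, Pi.smul_apply, h1, hsq', smul_eq_mul]
  have key : ∀ (u : ℝ) (a b : ℂ), ⟪toL2 (twoSided (sqrtUp z) u a b),
      -freeH f + conj z • (f : L2R)⟫_ℂ = (conj a - conj b) * F₁ u +
        Complex.I * -conj (sqrtUp z) * (conj a + conj b) * F u := fun u a b => by
    rw [inner_eq_integral (coeFn_toL2 (memLp_twoSided hs a b)) hψ]
    simp only [conj_twoSided]
    exact hF.integral_twoSided_mul hs' _ _
  have hc0 : conj (sqrtUp z) ≠ 0 := (map_ne_zero _).2 hs0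
  have hI := Complex.I_ne_zero
  rw [ht.trace_eq, inner_C2n, opG_apply, sum_inner]
  refine Finset.sum_congr rfl fun k _ => ?_
  rw [inner_add_left, inner_smul_left, inner_smul_left, toL2_green z, toL2_greenDeriv hz, key, key]
  simp only [map_div₀, map_mul, map_neg, map_one, Complex.conj_I, map_ofNat, if_pos, one_ne_zero,
    if_false]
  field_simp
  ring

end Trace

/-! ### The range and the kernel of the trace -/

section Range

variable {n : ℕ} {y : Fin n → ℝ}

theorem HasTrace.congr {ψ : L2R} {v w : C2n n} (h : HasTrace y ψ v)
    (e : ∀ k, v (k, 0) = w (k, 0) ∧ v (k, 1) = w (k, 1)) : HasTrace y ψ w := by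
  obtain ⟨g, a, b⟩ := h
  exact ⟨g, a, fun k => ⟨(e k).1 ▸ (b k).1, (e k).2 ▸ (b k).2⟩⟩

/-- Test functions belong to `H²(ℝ)`, and their traces are their boundary values. -/
theorem hasTrace_testFunction (y : Fin n → ℝ) {θ : ℝ → ℝ} (hθ : ContDiff ℝ ∞ θ)
    (hc : HasCompactSupport θ) : toL2 (fun x => (θ x : ℂ)) ∈ sobolevH2 univ ∧
      HasTrace y (toL2 fun x => (θ x : ℂ)) (WithLp.toLp 2 fun p =>
        if p.2 = 0 then (θ (y p.1) : ℂ) else ((deriv θ (y p.1) : ℝ) : ℂ)) := by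
  have p : ∀ χ : ℝ → ℝ, ContDiff ℝ ∞ χ →
      IsPrimitive (fun x => (χ x : ℂ)) (fun x => ((deriv χ x : ℝ) : ℂ)) := fun χ h =>
    IsPrimitive.of_hasDerivAt
      (fun x => (h.differentiable (by simp) x).hasDerivAt.ofReal_comp)
      (Complex.continuous_ofReal.comp (h.continuous_deriv (by norm_cast)))
  have d1 : ContDiff ℝ ∞ (deriv θ) := (contDiff_infty_iff_deriv.1 hθ).2
  have d2 : ContDiff ℝ ∞ (deriv (deriv θ)) := (contDiff_infty_iff_deriv.1 d1).2
  have m0 := memLp_ofReal hθ.continuous hc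
  have m1 := memLp_ofReal d1.continuous hc.deriv
  have h : IsH2 (fun x => (θ x : ℂ)) (fun x => ((deriv θ x : ℝ) : ℂ))
      (fun x => ((deriv (deriv θ) x : ℝ) : ℂ)) :=
    ⟨m0, m1, memLp_ofReal d2.continuous hc.deriv.deriv, p _ hθ, p _ d1⟩
  refine ⟨(h.mem_sobolevH2 (coeFn_toL2 m0)).1, toL2 fun x => ((deriv θ x : ℝ) : ℂ),
    ((p _ hθ).isWeakDeriv (coeFn_toL2 m0) (coeFn_toL2 m1)).mono (subset_univ _), fun k => ⟨?_, ?_⟩⟩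
  · exact hasMean_of_continuousAt (coeFn_toL2 m0) (p _ hθ).continuous.continuousAt
  · exact hasMean_of_continuousAt (coeFn_toL2 m1) (p _ d1).continuous.continuousAt

/-- The trace maps `H²(ℝ)` onto `ℂ²ⁿ`. -/
theorem exists_hasTrace (hy : Function.Injective y) (v : C2n n) :
    ∃ f ∈ sobolevH2 univ, HasTrace y f v := by
  classical
  have key : ∀ k, ∃ f ∈ sobolevH2 univ, ∃ g ∈ sobolevH2 univ,
      HasTrace y f (EuclideanSpace.single (k, 0) 1) ∧
        HasTrace y g (EuclideanSpace.single (k, 1) 1) := by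
    intro k
    -- a bump function at `y k` whose support avoids the other points
    have hfin : (y '' {k}ᶜ).Finite := toFinite _
    have hnot : y k ∉ y '' {k}ᶜ := fun ⟨j, hj, e⟩ => hj (hy e)
    obtain ⟨χ, hsupp, hcomp, hsm, -, h1⟩ := exists_contDiff_tsupport_subset (n := ⊤)
      (hfin.isClosed.isOpen_compl.mem_nhds hnot)
    have hoff : ∀ j, j ≠ k → y j ∉ tsupport χ := fun j hj hmem => hsupp hmem ⟨j, hj, rfl⟩
    have zero : ∀ p : ℝ → ℝ, ContDiff ℝ ∞ p → ∀ j, j ≠ k → χ (y j) = 0 ∧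
        deriv (fun x => p x * χ x) (y j) = 0 := fun p _ j hj => by
      have hts : tsupport (fun x => p x * χ x) ⊆ tsupport χ := tsupport_mul_subset_right
      refine ⟨image_eq_zero_of_notMem_tsupport (hoff j hj), ?_⟩
      exact image_eq_zero_of_notMem_tsupport fun h =>
        hoff j hj (hts (tsupport_deriv_subset h))
    have dχ : HasDerivAt χ (deriv χ (y k)) (y k) :=
      (hsm.differentiable (by simp) (y k)).hasDerivAt
    have d1 : HasDerivAt (fun x => (1 - deriv χ (y k) * (x - y k)) * χ x) 0 (y k) := by
      have := ((((hasDerivAt_id (y k)).sub_const (y k)).const_mul (deriv χ (y k))).const_sub 1).mul dχ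
      exact this.congr_deriv (by simp [h1])
    have d2 : HasDerivAt (fun x => (x - y k) * χ x) 1 (y k) := by
      have := ((hasDerivAt_id (y k)).sub_const (y k)).mul dχ
      exact this.congr_deriv (by simp [h1])
    have s1 : ContDiff ℝ ∞ fun x : ℝ => 1 - deriv χ (y k) * (x - y k) := by fun_prop
    have s2 : ContDiff ℝ ∞ fun x : ℝ => x - y k := by fun_prop
    obtain ⟨m1, t1⟩ := hasTrace_testFunction y (s1.mul hsm) hcomp.mul_left
    obtain ⟨m2, t2⟩ := hasTrace_testFunction y (s2.mul hsm) hcomp.mul_left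
    refine ⟨_, m1, _, m2, ?_, ?_⟩
    · refine t1.congr fun j => ?_
      by_cases hj : j = k
      · subst hj
        simp [h1, d1.deriv]
      · simp [hj, (zero _ s1 j hj).1, (zero _ s1 j hj).2]
    · refine t2.congr fun j => ?_
      by_cases hj : j = k
      · subst hj
        simp [h1, d2.deriv]
      · simp [hj, (zero _ s2 j hj).1, (zero _ s2 j hj).2]
  choose f hf g hg tf tg using key
  refine ⟨∑ k, (v (k, 0) • f k + v (k, 1) • g k), Submodule.sum_mem _ fun k _ =>
    add_mem (Submodule.smul_mem _ _ (hf k)) (Submodule.smul_mem _ _ (hg k)), ?_⟩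
  convert HasTrace.sum Finset.univ fun k => ((tf k).smul (v (k, 0))).add ((tg k).smul (v (k, 1)))
  ext ⟨j, l⟩
  rw [WithLp.ofLp_sum, Finset.sum_apply]
  fin_cases l <;> simp

/-- The kernel of the trace contains the test functions supported off `Y`, and thus is dense. -/
theorem dense_kerTrace (y : Fin n → ℝ) : Dense (kerTrace y : Set L2R) := by
  rw [Submodule.dense_iff_topologicalClosure_eq_top, Submodule.topologicalClosure_eq_top_iff,
    Submodule.eq_bot_iff]
  intro f hf
  have hY : (range y).Finite := finite_range y
  have ho : IsOpen (offY y) := hY.isClosed.isOpen_compl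
  have key : ∀ᵐ x ∂(volume : Measure ℝ), x ∈ offY y → f x = 0 := by
    refine ho.ae_eq_zero_of_integral_contDiff_smul_eq_zero
      ((locallyIntegrable_coeFn f).locallyIntegrableOn _) fun φ h1 h2 h3 => ?_
    obtain ⟨hm, ht⟩ := hasTrace_testFunction y h1 h2
    have hoff : ∀ k, y k ∉ tsupport φ := fun k h => h3 h ⟨k, rfl⟩
    have h0 : HasTrace y (toL2 fun x => (φ x : ℂ)) 0 := by
      refine ht.congr fun k => ?_
      have e1 := image_eq_zero_of_notMem_tsupport (hoff k)
      have e2 : deriv φ (y k) = 0 := image_eq_zero_of_notMem_tsupport fun h =>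
        hoff k (tsupport_deriv_subset h)
      simp [e1, e2]
    have hi := (Submodule.mem_orthogonal _ _).1 hf _ ⟨hm, h0⟩
    rw [inner_eq_integral (coeFn_toL2 (memLp_ofReal h1.continuous h2)) (ae_eq_refl _)] at hi
    simpa using hi
  refine Lp.ext ?_
  filter_upwards [key, compl_mem_ae_iff.2 (hY.measure_zero volume),
    Lp.coeFn_zero ℂ 2 (volume : Measure ℝ)] with x hx hxU h0
  rw [hx hxU, h0, Pi.zero_apply]

end Range

/-! ### Extensions of the kernel of a trace: the abstract setting -/

section Abstract

variable {E K : Type} [NormedAddCommGroup E] [InnerProductSpace ℂ E]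
  [NormedAddCommGroup K] [InnerProductSpace ℂ K]

/-- A symmetric operator `A`, its restriction `S` to the kernel of a trace `τ` with values in the
finite-dimensional space `K`, and the adjoints `G z` of `τ (-A + z̄)⁻¹`. The trace is defined on
the larger space `dom`, which also contains the ranges of the `G z`; off `dom` the value of `τ`
means nothing. The parameter `z` runs over a part `rho` of the resolvent set of `A`. -/
structure TraceData (E K : Type) [NormedAddCommGroup E] [InnerProductSpace ℂ E]
    [NormedAddCommGroup K] [InnerProductSpace ℂ K] where
  /-- The unperturbed operator. -/
  A : E →ₗ.[ℂ] E
  /-- The restriction of `A` to the kernel of the trace. -/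
  S : E →ₗ.[ℂ] E
  /-- The domain of the trace. -/
  dom : Submodule ℂ E
  /-- The trace. -/
  τ : E → K
  /-- The adjoints of `τ (-A + z̄)⁻¹`. -/
  G : ℂ → K →L[ℂ] E
  /-- The admissible spectral parameters. -/
  rho : Set ℂ
  τ_add : ∀ x ∈ dom, ∀ y ∈ dom, τ (x + y) = τ x + τ y
  τ_smul : ∀ (c : ℂ), ∀ x ∈ dom, τ (c • x) = c • τ x
  le_dom : A.domain ≤ dom
  G_mem : ∀ z ∈ rho, ∀ ξ, G z ξ ∈ dom
  symm : A.IsFormalAdjoint A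
  rho_sub : rho ⊆ resSet A
  conj_mem : ∀ z ∈ rho, conj z ∈ rho
  I_mem : Complex.I ∈ rho
  G_adj : ∀ z ∈ rho, ∀ ξ (x : A.domain), ⟪G z ξ, -A x + conj z • (x : E)⟫_ℂ = ⟪ξ, τ x⟫_ℂ
  τG_adj : ∀ z ∈ rho, ∀ ξ η, ⟪τ (G z ξ), η⟫_ℂ = ⟪ξ, τ (G (conj z) η)⟫_ℂ
  surj : ∀ v, ∃ x ∈ A.domain, τ x = v
  S_le : S ≤ A
  mem_S : ∀ x, x ∈ S.domain ↔ x ∈ A.domain ∧ τ x = 0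
  dense : Dense (S.domain : Set E)

namespace TraceData

variable (D : TraceData E K) {z w : ℂ}

theorem inner_resolvent_right (w : ℂ) (x y : D.A.domain) :
    ⟪(x : E), -D.A y + conj w • (y : E)⟫_ℂ = ⟪-D.A x + w • (x : E), (y : E)⟫_ℂ := by
  rw [inner_add_right, inner_neg_right, inner_add_left, inner_neg_left, inner_smul_right,
    inner_smul_left, D.symm x y]

theorem exists_resolvent (hz : z ∈ D.rho) (φ : E) : ∃ x : D.A.domain, -D.A x + z • (x : E) = φ := by
  obtain ⟨h, e⟩ := (resOp_spec (D.rho_sub hz)).1 φ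
  exact ⟨⟨_, h⟩, e⟩

theorem eq_zero_of_resolvent (hz : z ∈ D.rho) {x : D.A.domain} (h : -D.A x + z • (x : E) = 0) :
    (x : E) = 0 := by
  rw [← (resOp_spec (D.rho_sub hz)).2 x, h, map_zero]

theorem τ_zero : D.τ 0 = 0 := by
  simpa using D.τ_smul 0 0 D.dom.zero_mem

theorem τ_sub {x y : E} (hx : x ∈ D.dom) (hy : y ∈ D.dom) : D.τ (x - y) = D.τ x - D.τ y := by
  have := D.τ_add _ hx _ (D.dom.smul_mem (-1) hy)
  rw [D.τ_smul _ _ hy, neg_one_smul, neg_one_smul] at this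
  rw [sub_eq_add_neg, this, sub_eq_add_neg]

/-- The resolvent identity for `G`. -/
theorem G_sub_G (hz : z ∈ D.rho) (hw : w ∈ D.rho) (ξ : K) :
    D.G z ξ - D.G w ξ = (w - z) • resOp D.A w (D.G z ξ) := by
  obtain ⟨h, e⟩ := (resOp_spec (D.rho_sub hw)).1 (D.G z ξ)
  rw [← sub_eq_zero]
  refine ext_inner_right ℂ fun ψ => ?_
  obtain ⟨x, rfl⟩ := D.exists_resolvent (D.conj_mem w hw) ψ
  have h1 := D.G_adj z hz ξ x
  have h2 := D.G_adj w hw ξ x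
  have h3 := D.inner_resolvent_right w ⟨_, h⟩ x
  rw [e] at h3
  have h4 : -D.A x + conj w • (x : E) = (-D.A x + conj z • (x : E)) + (conj w - conj z) • (x : E) := by
    rw [sub_smul]
    abel
  rw [inner_zero_left, inner_sub_left, inner_sub_left, inner_smul_left, h3, h2, h4, inner_add_right,
    h1, inner_smul_right, map_sub]
  ring

theorem G_sub_mem (hz : z ∈ D.rho) (hw : w ∈ D.rho) (ξ : K) : D.G z ξ - D.G w ξ ∈ D.A.domain := by
  rw [D.G_sub_G hz hw]
  exact D.A.domain.smul_mem _ ((resOp_spec (D.rho_sub hw)).1 _).1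

/-- The ranges of the `G z` are transversal to the domain of `A`, since `S` is densely defined. -/
theorem eq_zero_of_G_mem (hz : z ∈ D.rho) {ξ : K} (h : D.G z ξ ∈ D.A.domain) : ξ = 0 := by
  have h0 : -D.A ⟨_, h⟩ + z • D.G z ξ = 0 := by
    refine D.dense.eq_zero_of_inner_left ℂ fun x hx => ?_
    obtain ⟨hxA, hxτ⟩ := (D.mem_S x).1 hx
    have := D.inner_resolvent_right z ⟨_, h⟩ ⟨x, hxA⟩
    rw [D.G_adj z hz, hxτ, inner_zero_right] at this
    exact this.symm
  have h1 : D.G z ξ = 0 := D.eq_zero_of_resolvent hz (x := ⟨_, h⟩) h0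
  obtain ⟨x, hx, e⟩ := D.surj ξ
  have := D.G_adj z hz ξ ⟨x, hx⟩
  rw [h1, inner_zero_left, e] at this
  exact inner_self_eq_zero.1 this.symm

/-- `Ψ` decomposes with the charge `ξ`, that is `Ψ - G z ξ ∈ dom A`. The choice `z = i` is
immaterial, see `hasCharge_iff`. -/
def HasCharge (Ψ : E) (ξ : K) : Prop := Ψ - D.G Complex.I ξ ∈ D.A.domain

variable {D} {Ψ Φ : E} {ξ η : K}

theorem hasCharge_iff (hz : z ∈ D.rho) : D.HasCharge Ψ ξ ↔ Ψ - D.G z ξ ∈ D.A.domain := by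
  have h := D.G_sub_mem hz D.I_mem ξ
  have e : Ψ - D.G Complex.I ξ = (Ψ - D.G z ξ) + (D.G z ξ - D.G Complex.I ξ) := by abel
  rw [HasCharge, e]
  exact Submodule.add_mem_iff_left _ h

theorem hasCharge_add (hz : z ∈ D.rho) (x : D.A.domain) (ξ : K) :
    D.HasCharge (x + D.G z ξ) ξ := by
  rw [hasCharge_iff hz, add_sub_cancel_right]
  exact x.2

theorem HasCharge.add (h : D.HasCharge Ψ ξ) (h' : D.HasCharge Φ η) :
    D.HasCharge (Ψ + Φ) (ξ + η) := by
  rw [HasCharge, map_add, add_sub_add_comm]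
  exact add_mem h h'

theorem HasCharge.smul (c : ℂ) (h : D.HasCharge Ψ ξ) : D.HasCharge (c • Ψ) (c • ξ) := by
  rw [HasCharge, map_smul, ← smul_sub]
  exact D.A.domain.smul_mem c h

theorem HasCharge.sub (h : D.HasCharge Ψ ξ) (h' : D.HasCharge Φ η) :
    D.HasCharge (Ψ - Φ) (ξ - η) := by
  rw [HasCharge, map_sub, sub_sub_sub_comm]
  exact sub_mem h h'

theorem hasCharge_zero_iff : D.HasCharge Ψ 0 ↔ Ψ ∈ D.A.domain := by
  rw [HasCharge, map_zero, sub_zero]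

theorem HasCharge.unique (h : D.HasCharge Ψ ξ) (h' : D.HasCharge Ψ η) : ξ = η := by
  have := h.sub h'
  rw [sub_self, HasCharge, zero_sub, neg_mem_iff] at this
  exact sub_eq_zero.1 (D.eq_zero_of_G_mem D.I_mem this)

theorem HasCharge.mem_dom (h : D.HasCharge Ψ ξ) : Ψ ∈ D.dom := by
  rw [← sub_add_cancel Ψ (D.G Complex.I ξ)]
  exact add_mem (D.le_dom h) (D.G_mem _ D.I_mem _)

theorem exists_hasCharge (ξ v : K) : ∃ Ψ, D.HasCharge Ψ ξ ∧ D.τ Ψ = v := by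
  obtain ⟨x, hx, e⟩ := D.surj (v - D.τ (D.G Complex.I ξ))
  refine ⟨x + D.G Complex.I ξ, hasCharge_add D.I_mem ⟨x, hx⟩ ξ, ?_⟩
  rw [D.τ_add _ (D.le_dom hx) _ (D.G_mem _ D.I_mem _), e, sub_add_cancel]

/-! ### The adjoint of the restriction -/

variable [CompleteSpace E]

theorem add_G_mem_adjoint (hz : z ∈ D.rho) (x : D.A.domain) (ξ : K) :
    ∃ h : (x : E) + D.G z ξ ∈ D.S.adjoint.domain,
      -D.S.adjoint ⟨_, h⟩ + z • ((x : E) + D.G z ξ) = -D.A x + z • (x : E) := by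
  have key : ∀ y : D.S.domain, ⟪D.A x + z • D.G z ξ, (y : E)⟫_ℂ = ⟪(x : E) + D.G z ξ, D.S y⟫_ℂ := by
    intro y
    obtain ⟨hyA, hyτ⟩ := (D.mem_S y).1 y.2
    have e : D.S y = D.A ⟨y, hyA⟩ := D.S_le.2 rfl
    have h1 := D.G_adj z hz ξ ⟨y, hyA⟩
    rw [hyτ, inner_zero_right, inner_add_right, inner_neg_right, inner_smul_right] at h1
    rw [e, inner_add_left, inner_add_left, D.symm x ⟨y, hyA⟩, inner_smul_left]
    linear_combination h1
  have h : (x : E) + D.G z ξ ∈ D.S.adjoint.domain :=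
    LinearPMap.mem_adjoint_domain_of_exists _ ⟨_, key⟩
  refine ⟨h, ?_⟩
  rw [LinearPMap.adjoint_apply_eq D.dense ⟨_, h⟩ key, smul_add]
  abel

/-- The adjoint of `S` has the domain `dom A + ran (G z)`. The range of `G z` is the orthogonal
complement of the range of `-S + z̄`. -/
theorem exists_of_mem_adjoint [FiniteDimensional ℂ K] (hz : z ∈ D.rho) (Ψ : D.S.adjoint.domain) :
    ∃ (x : D.A.domain) (ξ : K), (Ψ : E) = x + D.G z ξ := by
  obtain ⟨x, hx⟩ := D.exists_resolvent hz (-D.S.adjoint Ψ + z • (Ψ : E))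
  suffices h : (Ψ : E) - x ∈ LinearMap.range (D.G z : K →ₗ[ℂ] E) by
    obtain ⟨ξ, hξ⟩ := h
    exact ⟨x, ξ, by rw [← sub_eq_iff_eq_add']; exact hξ.symm⟩
  rw [← Submodule.orthogonal_orthogonal (LinearMap.range (D.G z : K →ₗ[ℂ] E)),
    Submodule.mem_orthogonal]
  intro v hv
  obtain ⟨y, rfl⟩ := D.exists_resolvent (D.conj_mem z hz) v
  have hτ : D.τ y = 0 := by
    refine inner_self_eq_zero (𝕜 := ℂ).1 ?_
    rw [← D.G_adj z hz]
    exact (Submodule.mem_orthogonal _ _).1 hv _ ⟨_, rfl⟩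
  have hy : (y : E) ∈ D.S.domain := (D.mem_S y).2 ⟨y.2, hτ⟩
  have e : D.S ⟨y, hy⟩ = D.A y := D.S_le.2 rfl
  have h1 := LinearPMap.adjoint_isFormalAdjoint D.dense Ψ ⟨y, hy⟩
  have h2 := D.inner_resolvent_right z x y
  rw [hx] at h2
  rw [← inner_conj_symm, inner_sub_left, h2, inner_add_left, inner_neg_left, h1, e, inner_add_right,
    inner_neg_right, inner_smul_right, inner_smul_left, sub_self, map_zero]

theorem mem_adjoint_iff [FiniteDimensional ℂ K] : Ψ ∈ D.S.adjoint.domain ↔ ∃ ξ, D.HasCharge Ψ ξ := by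
  constructor
  · intro h
    obtain ⟨x, ξ, e⟩ := exists_of_mem_adjoint D.I_mem ⟨Ψ, h⟩
    have e' : Ψ = x + D.G Complex.I ξ := e
    exact ⟨ξ, e' ▸ hasCharge_add D.I_mem x ξ⟩
  · rintro ⟨ξ, h⟩
    obtain ⟨h', -⟩ := add_G_mem_adjoint D.I_mem ⟨_, h⟩ ξ
    simpa using h'

theorem adjoint_apply (hz : z ∈ D.rho) (Ψ : D.S.adjoint.domain) (x : D.A.domain) (ξ : K)
    (e : (Ψ : E) = x + D.G z ξ) : -D.S.adjoint Ψ + z • (Ψ : E) = -D.A x + z • (x : E) := by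
  obtain ⟨h, h'⟩ := add_G_mem_adjoint hz x ξ
  obtain ⟨Ψ, hΨ⟩ := Ψ
  change Ψ = x + D.G z ξ at e
  subst e
  exact h'

/-- Green's identity: charge and trace form a boundary triple for the adjoint of `S`. -/
theorem green_identity (Ψ Φ : D.S.adjoint.domain) (h : D.HasCharge Ψ ξ) (h' : D.HasCharge Φ η) :
    ⟪(Ψ : E), D.S.adjoint Φ⟫_ℂ - ⟪D.S.adjoint Ψ, (Φ : E)⟫_ℂ =
      ⟪D.τ Ψ, η⟫_ℂ - ⟪ξ, D.τ Φ⟫_ℂ := by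
  have hz := D.I_mem
  set z := Complex.I with hzdef
  have hz' := D.conj_mem z hz
  set x : D.A.domain := ⟨_, (hasCharge_iff hz).1 h⟩ with hx
  set y : D.A.domain := ⟨_, (hasCharge_iff hz').1 h'⟩ with hy
  have ex : (Ψ : E) = x + D.G z ξ := (sub_add_cancel _ _).symm
  have ey : (Φ : E) = y + D.G (conj z) η := (sub_add_cancel _ _).symm
  have a1 := adjoint_apply hz Ψ x ξ ex
  have a2 := adjoint_apply hz' Φ y η ey
  have b1 : ⟪-D.S.adjoint Ψ + z • (Ψ : E), (Φ : E)⟫_ℂ =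
      ⟪-D.A x + z • (x : E), (y : E)⟫_ℂ + ⟪D.τ x, η⟫_ℂ := by
    have := D.G_adj _ hz' η x
    rw [Complex.conj_conj] at this
    rw [a1, ey, inner_add_right, ← inner_conj_symm _ (D.G _ η), this, inner_conj_symm]
  have b2 : ⟪(Ψ : E), -D.S.adjoint Φ + conj z • (Φ : E)⟫_ℂ =
      ⟪-D.A x + z • (x : E), (y : E)⟫_ℂ + ⟪ξ, D.τ y⟫_ℂ := by
    rw [a2, ex, inner_add_left, D.G_adj _ hz, D.inner_resolvent_right]
  have t1 : D.τ Ψ = D.τ x + D.τ (D.G z ξ) := by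
    rw [ex, D.τ_add _ (D.le_dom x.2) _ (D.G_mem _ hz _)]
  have t2 : D.τ Φ = D.τ y + D.τ (D.G (conj z) η) := by
    rw [ey, D.τ_add _ (D.le_dom y.2) _ (D.G_mem _ hz' _)]
  rw [inner_add_left, inner_neg_left, inner_smul_left] at b1
  rw [inner_add_right, inner_neg_right, inner_smul_right] at b2
  rw [t1, t2, inner_add_left, inner_add_right, D.τG_adj z hz]
  linear_combination b1 - b2

end TraceData

end Abstract

section Abstract

variable {E K : Type} [NormedAddCommGroup E] [InnerProductSpace ℂ E] [CompleteSpace E]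
  [NormedAddCommGroup K] [InnerProductSpace ℂ K]

/-! ### Linear relations and self-adjoint extensions -/

/-- The adjoint of a linear relation `L` in `K`. -/
def relAdjoint (L : Submodule ℂ (K × K)) : Submodule ℂ (K × K) where
  carrier := {q | ∀ p ∈ L, ⟪p.2, q.1⟫_ℂ = ⟪p.1, q.2⟫_ℂ}
  add_mem' := fun ha hb p hp => by
    rw [Prod.fst_add, Prod.snd_add, inner_add_right, inner_add_right, ha p hp, hb p hp]
  zero_mem' := fun p _ => by simp
  smul_mem' := fun c _ ha p hp => by
    rw [Prod.smul_fst, Prod.smul_snd, inner_smul_right, inner_smul_right, ha p hp]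

namespace TraceData

variable (D : TraceData E K) {z : ℂ}

/-- The vectors whose charge and trace form a pair in the linear relation `L`. -/
def extDomain (L : Submodule ℂ (K × K)) : Submodule ℂ E where
  carrier := {Ψ | ∃ ξ, D.HasCharge Ψ ξ ∧ (ξ, D.τ Ψ) ∈ L}
  add_mem' := by
    rintro _ _ ⟨ξ, h, m⟩ ⟨η, h', m'⟩
    refine ⟨ξ + η, h.add h', ?_⟩
    rw [D.τ_add _ h.mem_dom _ h'.mem_dom]
    exact L.add_mem m m'
  zero_mem' := ⟨0, hasCharge_zero_iff.2 D.A.domain.zero_mem, by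
    rw [D.τ_zero]
    exact L.zero_mem⟩
  smul_mem' := by
    rintro c _ ⟨ξ, h, m⟩
    refine ⟨c • ξ, h.smul c, ?_⟩
    rw [D.τ_smul _ _ h.mem_dom]
    exact L.smul_mem c m

/-- The extension of `S` that belongs to the linear relation `L`. -/
def ext (L : Submodule ℂ (K × K)) : E →ₗ.[ℂ] E := D.S.adjoint.domRestrict (D.extDomain L)

variable {D} {Ψ Φ : E} {ξ η : K} {L L' : Submodule ℂ (K × K)}

theorem ext_le_adjoint : D.ext L ≤ D.S.adjoint := LinearPMap.domRestrict_le

theorem ext_apply (Ψ : (D.ext L).domain) :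
    D.ext L Ψ = D.S.adjoint ⟨Ψ, ext_le_adjoint.1 Ψ.2⟩ := ext_le_adjoint.2 rfl

theorem S_le_adjoint : D.S ≤ D.S.adjoint := by
  refine LinearPMap.IsFormalAdjoint.le_adjoint D.dense fun x y => ?_
  have e : ∀ x : D.S.domain, D.S x = D.A ⟨x, D.S_le.1 x.2⟩ := fun x => D.S_le.2 rfl
  rw [e, e]
  exact D.symm ⟨x, D.S_le.1 x.2⟩ ⟨y, D.S_le.1 y.2⟩

theorem adjoint_le_of_S_le {T : E →ₗ.[ℂ] E} (h : D.S ≤ T) : T.adjoint ≤ D.S.adjoint := by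
  have hT : Dense (T.domain : Set E) := D.dense.mono h.1
  refine LinearPMap.IsFormalAdjoint.le_adjoint D.dense fun x y => ?_
  have e : D.S x = T ⟨x, h.1 x.2⟩ := h.2 rfl
  rw [e]
  exact (LinearPMap.adjoint_isFormalAdjoint hT).symm _ _

/-- A restriction of the adjoint of `S` is determined by its domain. -/
theorem eq_ext_of_domain {T : E →ₗ.[ℂ] E} (h : T ≤ D.S.adjoint)
    (hd : ∀ Ψ, Ψ ∈ T.domain ↔ Ψ ∈ (D.ext L).domain) : T = D.ext L := by
  refine LinearPMap.ext (Submodule.ext hd) fun x hx hy => ?_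
  exact (h.2 rfl : T ⟨x, hx⟩ = D.S.adjoint ⟨x, h.1 hx⟩).trans (ext_apply ⟨x, hy⟩).symm

variable [FiniteDimensional ℂ K]

theorem mem_ext_domain : Ψ ∈ (D.ext L).domain ↔ ∃ ξ, D.HasCharge Ψ ξ ∧ (ξ, D.τ Ψ) ∈ L := by
  constructor
  · exact fun h => h.1
  · exact fun h => ⟨h, mem_adjoint_iff.2 ⟨_, h.choose_spec.1⟩⟩

theorem S_le_ext : D.S ≤ D.ext L := by
  refine ⟨fun x hx => mem_ext_domain.2 ⟨0, ?_, ?_⟩, fun x y hxy => ?_⟩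
  · exact hasCharge_zero_iff.2 (D.S_le.1 hx)
  · rw [((D.mem_S x).1 hx).2]
    exact L.zero_mem
  · rw [ext_apply]
    exact S_le_adjoint.2 hxy

theorem dense_ext : Dense ((D.ext L).domain : Set E) := D.dense.mono S_le_ext.1

theorem mem_iff_exists_ext (p : K × K) :
    p ∈ L ↔ ∃ Ψ ∈ (D.ext L).domain, D.HasCharge Ψ p.1 ∧ D.τ Ψ = p.2 := by
  constructor
  · intro hp
    obtain ⟨Ψ, h1, h2⟩ := D.exists_hasCharge p.1 p.2
    exact ⟨Ψ, mem_ext_domain.2 ⟨_, h1, by rw [h2]; exact hp⟩, h1, h2⟩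
  · rintro ⟨Ψ, hΨ, h1, h2⟩
    obtain ⟨ξ, h3, h4⟩ := mem_ext_domain.1 hΨ
    rwa [← h1.unique h3, h2] at h4

theorem ext_injective : Function.Injective (D.ext : Submodule ℂ (K × K) → E →ₗ.[ℂ] E) := by
  intro L L' h
  refine Submodule.ext fun p => ?_
  rw [mem_iff_exists_ext (D := D), h, ← mem_iff_exists_ext]

/-- Adjoints of extensions correspond to adjoints of linear relations, by Green's identity. -/
theorem adjoint_ext (L : Submodule ℂ (K × K)) : (D.ext L).adjoint = D.ext (relAdjoint L) := by
  have hle : (D.ext L).adjoint ≤ D.S.adjoint := adjoint_le_of_S_le S_le_ext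
  refine eq_ext_of_domain hle fun Φ => ?_
  constructor
  · intro hΦ
    have hΦ' := hle.1 hΦ
    obtain ⟨η, hη⟩ := mem_adjoint_iff.1 hΦ'
    refine mem_ext_domain.2 ⟨η, hη, fun p hp => ?_⟩
    obtain ⟨Ψ, hΨ, h1, h2⟩ := (mem_iff_exists_ext (D := D) p).1 hp
    have g := green_identity ⟨Ψ, ext_le_adjoint.1 hΨ⟩ ⟨Φ, hΦ'⟩ h1 hη
    have a := (LinearPMap.adjoint_isFormalAdjoint (T := D.ext L) dense_ext).symm ⟨Ψ, hΨ⟩ ⟨Φ, hΦ⟩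
    have e : ((D.ext L).adjoint : E →ₗ.[ℂ] E) ⟨Φ, hΦ⟩ = D.S.adjoint ⟨Φ, hΦ'⟩ := hle.2 rfl
    rw [e, ext_apply] at a
    rw [← sub_eq_zero, ← h2]
    rw [← g, sub_eq_zero]
    exact a.symm
  · intro hΦ
    obtain ⟨η, hη, hL⟩ := mem_ext_domain.1 hΦ
    have hΦ' := ext_le_adjoint.1 hΦ
    refine LinearPMap.mem_adjoint_domain_of_exists _ ⟨D.S.adjoint ⟨Φ, hΦ'⟩, fun Ψ => ?_⟩
    obtain ⟨ξ, hξ, hp⟩ := mem_ext_domain.1 Ψ.2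
    have g := green_identity (D := D) ⟨(Ψ : E), ext_le_adjoint.1 Ψ.2⟩ ⟨Φ, hΦ'⟩ hξ hη
    rw [hL _ hp, sub_self, sub_eq_zero] at g
    rw [ext_apply, ← inner_conj_symm, g, inner_conj_symm]

theorem isSelfAdjoint_ext (h : relAdjoint L = L) : IsSelfAdjoint (D.ext L) := by
  rw [LinearPMap.isSelfAdjoint_def, adjoint_ext, h]

theorem exists_eq_ext {T : E →ₗ.[ℂ] E} (hT : IsSelfAdjoint T) (h : D.S ≤ T) :
    ∃ L, relAdjoint L = L ∧ T = D.ext L := by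
  rw [LinearPMap.isSelfAdjoint_def] at hT
  have hle : T ≤ D.S.adjoint := hT ▸ adjoint_le_of_S_le h
  have hdom : ∀ {Ψ ξ}, D.HasCharge Ψ ξ → Ψ ∈ D.dom := fun h => h.mem_dom
  let L : Submodule ℂ (K × K) :=
    { carrier := {p | ∃ Ψ ∈ T.domain, D.HasCharge Ψ p.1 ∧ D.τ Ψ = p.2}
      add_mem' := by
        rintro _ _ ⟨Ψ, hΨ, h1, h2⟩ ⟨Φ, hΦ, h3, h4⟩
        exact ⟨Ψ + Φ, add_mem hΨ hΦ, h1.add h3, by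
          rw [D.τ_add _ (hdom h1) _ (hdom h3), h2, h4, Prod.snd_add]⟩
      zero_mem' := ⟨0, zero_mem _, hasCharge_zero_iff.2 (zero_mem _), D.τ_zero⟩
      smul_mem' := by
        rintro c _ ⟨Ψ, hΨ, h1, h2⟩
        exact ⟨c • Ψ, T.domain.smul_mem c hΨ, h1.smul c, by
          rw [D.τ_smul _ _ (hdom h1), h2, Prod.smul_snd]⟩ }
  have e : T = D.ext L := by
    refine eq_ext_of_domain hle fun Ψ => ?_
    rw [mem_ext_domain]
    constructor
    · intro hΨ
      obtain ⟨ξ, hξ⟩ := mem_adjoint_iff.1 (hle.1 hΨ)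
      exact ⟨ξ, hξ, Ψ, hΨ, hξ, rfl⟩
    · rintro ⟨ξ, hξ, Φ, hΦ, h1, h2⟩
      have hS : Ψ - Φ ∈ D.S.domain := by
        rw [D.mem_S]
        have := hξ.sub h1
        rw [sub_self, hasCharge_zero_iff] at this
        refine ⟨this, ?_⟩
        rw [D.τ_sub (hdom hξ) (hdom h1), h2, sub_self]
      rw [← sub_add_cancel Ψ Φ]
      exact add_mem (h.1 hS) hΦ
  refine ⟨L, ext_injective (D := D) ?_, e⟩
  rw [← adjoint_ext, ← e, hT]

/-! ### The restriction is closed, and its defect spaces -/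

theorem adjoint_G_apply (hz : z ∈ D.rho) (φ : E) :
    ContinuousLinearMap.adjoint (D.G (conj z)) φ = D.τ (resOp D.A z φ) := by
  obtain ⟨h, e⟩ := (resOp_spec (D.rho_sub hz)).1 φ
  refine ext_inner_left ℂ fun ξ => ?_
  have := D.G_adj _ (D.conj_mem z hz) ξ ⟨_, h⟩
  rw [Complex.conj_conj, e] at this
  rw [ContinuousLinearMap.adjoint_inner_right, this]

theorem isClosed_S : D.S.IsClosed := by
  have hz := D.I_mem
  set z := Complex.I
  have hR := resOp_spec (D.rho_sub hz)
  have e : (D.S.graph : Set (E × E)) = {p | p.1 = resOp D.A z (z • p.1 - p.2)} ∩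
      {p | ContinuousLinearMap.adjoint (D.G (conj z)) (z • p.1 - p.2) = 0} := by
    ext ⟨x, u⟩
    simp only [SetLike.mem_coe, LinearPMap.mem_graph_iff, mem_inter_iff, mem_ofPred_eq,
      adjoint_G_apply hz]
    constructor
    · rintro ⟨y, rfl, rfl⟩
      obtain ⟨hyA, hyτ⟩ := (D.mem_S y).1 y.2
      have e : D.S y = D.A ⟨y, hyA⟩ := D.S_le.2 rfl
      have := hR.2 ⟨y, hyA⟩
      rw [neg_add_eq_sub, ← e] at this
      exact ⟨this.symm, by rw [this, hyτ]⟩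
    · rintro ⟨h1, h2⟩
      obtain ⟨h, e⟩ := hR.1 (z • x - u)
      have hx : x ∈ D.A.domain := h1 ▸ h
      have hS : x ∈ D.S.domain := (D.mem_S x).2 ⟨hx, by rw [h1, h2]⟩
      refine ⟨⟨x, hS⟩, rfl, ?_⟩
      have e1 : D.S ⟨x, hS⟩ = D.A ⟨x, hx⟩ := D.S_le.2 rfl
      have e2 : ∀ v (hv : v ∈ D.A.domain), v = x → -D.A ⟨v, hv⟩ + z • v = z • x - u →
          D.A ⟨x, hx⟩ = u := by
        rintro v hv rfl e
        rw [neg_add_eq_sub] at e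
        exact sub_right_injective e
      rw [e1]
      exact e2 _ h h1.symm e
  rw [LinearPMap.IsClosed, e]
  refine (isClosed_eq ?_ ?_).inter (isClosed_eq ?_ ?_) <;> fun_prop

/-- The defect space at `z` is the range of `G z`. -/
theorem rank_defectSpace (hz : z ∈ D.rho) :
    Module.rank ℂ (defectSpace D.S z) = Module.rank ℂ K := by
  have key : ∀ ξ, ∃ h : D.G z ξ ∈ D.S.adjoint.domain, D.S.adjoint ⟨_, h⟩ = z • D.G z ξ := by
    intro ξ
    have := add_G_mem_adjoint hz 0 ξ
    rw [Submodule.coe_zero, zero_add] at this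
    obtain ⟨h, e⟩ := this
    rw [LinearPMap.map_zero, neg_zero, smul_zero, add_zero] at e
    exact ⟨h, neg_add_eq_zero.1 e⟩
  choose h1 h2 using key
  let f : K →ₗ[ℂ] defectSpace D.S z :=
    { toFun := fun ξ => ⟨⟨D.G z ξ, h1 ξ⟩, by
        rw [defectSpace, LinearMap.mem_ker, LinearMap.sub_apply, sub_eq_zero]
        exact h2 ξ⟩
      map_add' := fun ξ η => Subtype.ext (Subtype.ext (map_add _ _ _))
      map_smul' := fun c ξ => Subtype.ext (Subtype.ext (map_smul _ _ _)) }
  refine (LinearEquiv.ofBijective f ⟨?_, ?_⟩).rank_eq.symm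
  · intro ξ η e
    have e' : D.G z ξ = D.G z η := congrArg (fun Ψ : defectSpace D.S z => ((Ψ : D.S.adjoint.domain) : E)) e
    rw [← sub_eq_zero]
    refine D.eq_zero_of_G_mem hz ?_
    rw [map_sub, e', sub_self]
    exact zero_mem _
  · rintro ⟨Ψ, hΨ⟩
    have hk : D.S.adjoint Ψ = z • (Ψ : E) := by
      rw [defectSpace, LinearMap.mem_ker, LinearMap.sub_apply, sub_eq_zero] at hΨ
      exact hΨ
    obtain ⟨x, ξ, e⟩ := exists_of_mem_adjoint hz Ψ
    have := adjoint_apply hz Ψ x ξ e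
    rw [hk, neg_add_cancel] at this
    have hx := D.eq_zero_of_resolvent hz this.symm
    refine ⟨ξ, Subtype.ext (Subtype.ext ?_)⟩
    change D.G z ξ = Ψ
    rw [e, hx, zero_add]

end TraceData

end Abstract

section Abstract

variable {E K : Type} [NormedAddCommGroup E] [InnerProductSpace ℂ E] [CompleteSpace E]
  [NormedAddCommGroup K] [InnerProductSpace ℂ K]

/-! ### Self-adjoint relations as couples of a projector and a symmetric operator -/

/-- The linear relation `{(ξ, v) : ξ ∈ ran P, P v = θ ξ}`. -/
def coupleRel (P : K →ₗ[ℂ] K) (θ : LinearMap.range P →ₗ[ℂ] LinearMap.range P) :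
    Submodule ℂ (K × K) where
  carrier := {p | ∃ η : LinearMap.range P, p.1 = η ∧ P.rangeRestrict p.2 = θ η}
  add_mem' := by
    rintro _ _ ⟨η, h1, h2⟩ ⟨η', h1', h2'⟩
    exact ⟨η + η', by rw [Prod.fst_add, h1, h1', Submodule.coe_add],
      by rw [Prod.snd_add, map_add, h2, h2', map_add]⟩
  zero_mem' := ⟨0, rfl, by rw [Prod.snd_zero, map_zero, map_zero]⟩
  smul_mem' := by
    rintro c _ ⟨η, h1, h2⟩
    exact ⟨c • η, by rw [Prod.smul_fst, h1, Submodule.coe_smul],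
      by rw [Prod.smul_snd, map_smul, h2, map_smul]⟩

section Couple

variable {P : K →ₗ[ℂ] K} {θ : LinearMap.range P →ₗ[ℂ] LinearMap.range P}

theorem proj_apply_range (hP : P.IsSymmetricProjection) (η : LinearMap.range P) :
    P η = η := by
  obtain ⟨_, u, rfl⟩ := η
  exact LinearMap.congr_fun hP.isIdempotentElem u

theorem relAdjoint_coupleRel (hP : P.IsSymmetricProjection)
    (hθ : ∀ ξ η : LinearMap.range P, ⟪(θ ξ : K), (η : K)⟫_ℂ = ⟪(ξ : K), (θ η : K)⟫_ℂ) :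
    relAdjoint (coupleRel P θ) = coupleRel P θ := by
  have hPP := proj_apply_range hP
  have hs := hP.isSymmetric
  ext ⟨η, w⟩
  constructor
  · intro h
    have h1 : P η = η := by
      refine ext_inner_left ℂ fun u => ?_
      have := h (0, u - P u) ⟨0, rfl, by
        refine Subtype.ext ?_
        change P (u - P u) = (θ 0 : K)
        rw [map_sub, hPP ⟨P u, u, rfl⟩, sub_self, map_zero]
        rfl⟩
      rw [inner_zero_left, inner_sub_left, sub_eq_zero] at this
      exact (hs u η).symm.trans this.symm
    set η' : LinearMap.range P := ⟨η, η, h1⟩ with hη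
    refine ⟨η', rfl, Subtype.ext (ext_inner_left ℂ fun u => ?_)⟩
    set u' : LinearMap.range P := ⟨P u, u, rfl⟩ with hu
    have e : ⟪(θ u' : K), (η' : K)⟫_ℂ = ⟪P u, w⟫_ℂ :=
      h (P u, θ u') ⟨u', rfl, Subtype.ext (hPP _)⟩
    change ⟪u, P w⟫_ℂ = ⟪u, (θ η' : K)⟫_ℂ
    rw [← hs u w, ← e, hθ, ← hPP (θ η'), ← hs u, hPP (θ η')]
  · rintro ⟨η', rfl : η = η', h2⟩ ⟨_, v⟩ ⟨ξ, rfl, h4⟩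
    have h2' : P w = θ η' := congrArg Subtype.val h2
    have h4' : P v = θ ξ := congrArg Subtype.val h4
    change ⟪v, (η' : K)⟫_ℂ = ⟪(ξ : K), w⟫_ℂ
    rw [← hPP η', ← hs v, h4', hθ, ← h2', ← hs, hPP]

theorem mem_range_iff_exists_mem_coupleRel (hP : P.IsSymmetricProjection) (ξ : K) :
    ξ ∈ LinearMap.range P ↔ ∃ v, (ξ, v) ∈ coupleRel P θ := by
  constructor
  · exact fun h => ⟨θ ⟨ξ, h⟩, ⟨ξ, h⟩, rfl, Subtype.ext (proj_apply_range hP _)⟩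
  · rintro ⟨v, η, rfl : ξ = η, -⟩
    exact η.2

theorem mem_coupleRel_iff (ξ : LinearMap.range P) (v : K) :
    ((ξ : K), v) ∈ coupleRel P θ ↔ P.rangeRestrict v = θ ξ := by
  constructor
  · rintro ⟨η, h1, h2⟩
    rwa [Subtype.ext h1]
  · exact fun h => ⟨ξ, rfl, h⟩

/-- Every self-adjoint relation comes from a couple: the projector is the one onto the domain of
the relation, whose orthogonal complement is the multivalued part. -/
theorem exists_coupleRel_eq [FiniteDimensional ℂ K] {L : Submodule ℂ (K × K)}
    (hL : relAdjoint L = L) :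
    ∃ (P : K →ₗ[ℂ] K) (θ : LinearMap.range P →ₗ[ℂ] LinearMap.range P),
      P.IsSymmetricProjection ∧
      (∀ ξ η : LinearMap.range P, ⟪(θ ξ : K), (η : K)⟫_ℂ = ⟪(ξ : K), (θ η : K)⟫_ℂ) ∧
      coupleRel P θ = L := by
  set V := L.map (LinearMap.fst ℂ K K) with hV
  set P : K →ₗ[ℂ] K := V.starProjection.toLinearMap with hPdef
  have hP : P.IsSymmetricProjection := V.isSymmetricProjection_starProjection
  have hr : LinearMap.range P = V := V.range_starProjection
  have hPP := proj_apply_range hP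
  have hs := hP.isSymmetric
  have hmem : ∀ p ∈ L, p.1 ∈ LinearMap.range P := fun p hp => hr ▸ ⟨p, hp, rfl⟩
  -- the multivalued part of the relation is the kernel of the projector
  have hmul : ∀ v, ((0 : K), v) ∈ L ↔ P v = 0 := by
    intro v
    rw [← hL]
    constructor
    · intro h
      refine ext_inner_left ℂ fun u => ?_
      obtain ⟨p, hp, e⟩ : P u ∈ V := hr ▸ ⟨u, rfl⟩
      have := h p hp
      rw [inner_zero_right] at this
      rw [← hs u v, ← e, inner_zero_right]
      exact this.symm
    · intro h p hp
      have : P p.1 = p.1 := hPP ⟨p.1, hmem p hp⟩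
      rw [inner_zero_right, ← this, hs, h, inner_zero_right]
  let q : L →ₗ[ℂ] LinearMap.range P :=
    ((LinearMap.fst ℂ K K).comp L.subtype).codRestrict _ fun p => hmem p p.2
  have hq : LinearMap.range q = ⊤ := by
    rw [LinearMap.range_eq_top]
    rintro ⟨ξ, hξ⟩
    obtain ⟨p, hp, e⟩ : ξ ∈ V := hr ▸ hξ
    exact ⟨⟨p, hp⟩, Subtype.ext e⟩
  obtain ⟨s, hsq⟩ := q.exists_rightInverse_of_surjective hq
  have hs1 : ∀ ξ, ((s ξ : K × K)).1 = ξ := fun ξ =>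
    congrArg Subtype.val (LinearMap.congr_fun hsq ξ)
  let θ : LinearMap.range P →ₗ[ℂ] LinearMap.range P :=
    P.rangeRestrict ∘ₗ (LinearMap.snd ℂ K K) ∘ₗ L.subtype ∘ₗ s
  have hθ : ∀ ξ, (θ ξ : K) = P (s ξ : K × K).2 := fun ξ => rfl
  refine ⟨P, θ, hP, fun ξ η => ?_, ?_⟩
  · have hm : (s η : K × K) ∈ relAdjoint L := by
      rw [hL]
      exact (s η).2
    have h := hm (s ξ) (s ξ).2
    rw [hs1, hs1] at h
    rw [hθ, hθ, hs, hPP, h, ← hs, hPP]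
  · have key : ∀ (ξ : LinearMap.range P) (v : K), ((ξ : K), v) ∈ L ↔ P v = θ ξ := by
      intro ξ v
      have e : ((ξ : K), v) = (s ξ : K × K) + (0, v - (s ξ : K × K).2) := by
        rw [← hs1 ξ]
        ext <;> simp
      rw [e, Submodule.add_mem_iff_right _ (s ξ).2, hmul, map_sub, sub_eq_zero, hθ]
    ext ⟨ξ, v⟩
    constructor
    · rintro ⟨η, rfl : ξ = η, h⟩
      have h' := congrArg Subtype.val h
      exact (key η v).2 h'
    · intro h
      exact ⟨⟨ξ, hmem _ h⟩, rfl, Subtype.ext ((key ⟨ξ, hmem _ h⟩ v).1 h)⟩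

end Couple

/-! ### The resolvent formula -/

namespace TraceData

variable {D : TraceData E K} {z : ℂ} {P : K →ₗ[ℂ] K} {θ : LinearMap.range P →ₗ[ℂ] LinearMap.range P}

theorem ext_action (hz : z ∈ D.rho) {L : Submodule ℂ (K × K)} (Ψ : (D.ext L).domain)
    (x : D.A.domain) (ξ : K) (e : (Ψ : E) = x + D.G z ξ) :
    -D.ext L Ψ + z • (Ψ : E) = -D.A x + z • (x : E) := by
  rw [ext_apply]
  exact adjoint_apply hz ⟨Ψ, _⟩ x ξ e

variable [FiniteDimensional ℂ K]

theorem mem_ext_coupleRel (hz : z ∈ D.rho) {Ψ : E} : Ψ ∈ (D.ext (coupleRel P θ)).domain ↔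
    ∃ x ∈ D.A.domain, ∃ ξ : LinearMap.range P, Ψ = x + D.G z ξ ∧
      P.rangeRestrict (D.τ Ψ) = θ ξ := by
  rw [mem_ext_domain]
  constructor
  · rintro ⟨_, h, ξ, rfl, h2⟩
    exact ⟨_, (hasCharge_iff hz).1 h, ξ, (sub_add_cancel _ _).symm, h2⟩
  · rintro ⟨x, hx, ξ, rfl, h⟩
    exact ⟨ξ, hasCharge_add hz ⟨x, hx⟩ ξ, ξ, rfl, h⟩

theorem bijective_gamma (hz : z ∈ D.rho) (hz' : z ∈ resSet (D.ext (coupleRel P θ))) :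
    Function.Bijective fun ξ : LinearMap.range P => θ ξ - P.rangeRestrict (D.τ (D.G z ξ)) := by
  let N : LinearMap.range P →ₗ[ℂ] K :=
    { toFun := fun ξ => D.τ (D.G z ξ)
      map_add' := fun ξ η => by
        rw [Submodule.coe_add, map_add, D.τ_add _ (D.G_mem z hz _) _ (D.G_mem z hz _)]
      map_smul' := fun c ξ => by
        rw [Submodule.coe_smul, map_smul, D.τ_smul _ _ (D.G_mem z hz _), RingHom.id_apply] }
  let M : LinearMap.range P →ₗ[ℂ] LinearMap.range P := θ - P.rangeRestrict ∘ₗ N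
  have hM : Function.Injective M := by
    rw [injective_iff_map_eq_zero]
    intro ξ hξ
    have hm : D.G z ξ ∈ (D.ext (coupleRel P θ)).domain :=
      (mem_ext_coupleRel hz).2 ⟨0, zero_mem _, ξ, (zero_add _).symm, (sub_eq_zero.1 hξ).symm⟩
    have h := ext_action hz ⟨_, hm⟩ 0 ξ (zero_add _).symm
    rw [LinearPMap.map_zero, Submodule.coe_zero, smul_zero, neg_zero, add_zero] at h
    have h0 := (resOp_spec hz').2 ⟨_, hm⟩
    rw [h, map_zero] at h0
    refine Subtype.ext (D.eq_zero_of_G_mem hz ?_)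
    rw [← show (0 : E) = D.G z ξ from h0]
    exact zero_mem _
  exact ⟨hM, LinearMap.injective_iff_surjective.1 hM⟩

theorem resOp_ext (hz : z ∈ D.rho) (hz' : z ∈ resSet (D.ext (coupleRel P θ))) (Ψ : E)
    (ξ : LinearMap.range P) (hξ : θ ξ - P.rangeRestrict (D.τ (D.G z ξ)) =
      P.rangeRestrict (ContinuousLinearMap.adjoint (D.G (conj z)) Ψ)) :
    resOp (D.ext (coupleRel P θ)) z Ψ = resOp D.A z Ψ + D.G z ξ := by
  obtain ⟨hx, e⟩ := (resOp_spec (D.rho_sub hz)).1 Ψ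
  rw [adjoint_G_apply hz] at hξ
  have hm : resOp D.A z Ψ + D.G z ξ ∈ (D.ext (coupleRel P θ)).domain := by
    refine (mem_ext_coupleRel hz).2 ⟨_, hx, ξ, rfl, ?_⟩
    rw [D.τ_add _ (D.le_dom hx) _ (D.G_mem z hz _), map_add, ← hξ, sub_add_cancel]
  have h := ext_action hz ⟨_, hm⟩ ⟨_, hx⟩ ξ rfl
  have h0 := (resOp_spec hz').2 ⟨_, hm⟩
  rw [h, e] at h0
  exact h0

end TraceData

end Abstract

/-! ### Doubling -/

section Double

variable {E Z : Type} [NormedAddCommGroup E] [InnerProductSpace ℂ E]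
  [NormedAddCommGroup Z] [InnerProductSpace ℂ Z]

/-- `L𝟙 = L ⊕ L` for a bounded operator `L`. -/
def dblCLM (L : E →L[ℂ] Z) : Dbl E →L[ℂ] Dbl Z :=
  ((PiLp.continuousLinearEquiv 2 ℂ (fun _ : Fin 2 => Z)).symm : (Fin 2 → Z) →L[ℂ] Dbl Z) ∘L
    (ContinuousLinearMap.piMap fun _ => L) ∘L
      (PiLp.continuousLinearEquiv 2 ℂ (fun _ : Fin 2 => E) : Dbl E →L[ℂ] (Fin 2 → E))

theorem adjoint_dblCLM [CompleteSpace E] [CompleteSpace Z] (L : E →L[ℂ] Z) (Ψ : Dbl Z) :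
    ContinuousLinearMap.adjoint (dblCLM L) Ψ = dblFun (ContinuousLinearMap.adjoint L) Ψ := by
  refine ext_inner_left ℂ fun Φ => ?_
  rw [ContinuousLinearMap.adjoint_inner_right, PiLp.inner_apply, PiLp.inner_apply]
  exact Finset.sum_congr rfl fun j _ => (ContinuousLinearMap.adjoint_inner_right L (Φ j) (Ψ j)).symm

theorem isResolventAt_dbl {T : E →ₗ.[ℂ] E} {z : ℂ} {R : E →L[ℂ] E} (h : IsResolventAt T z R) :
    IsResolventAt (dblPMap T) z (dblCLM R) := by
  refine ⟨fun Ψ => ?_, fun Ψ => ?_⟩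
  · choose h1 h2 using h.1
    exact ⟨fun j => h1 (Ψ j), by ext j; exact h2 (Ψ j)⟩
  · ext j
    exact h.2 ⟨(Ψ : Dbl E) j, Ψ.2 j⟩

theorem resOp_dbl {T : E →ₗ.[ℂ] E} {z : ℂ} (hz : z ∈ resSet T) :
    resOp (dblPMap T) z = dblCLM (resOp T z) := by
  have h := isResolventAt_dbl (resOp_spec hz)
  exact (resOp_spec (T := dblPMap T) ⟨_, h⟩).unique h

theorem dense_dblPMap {T : E →ₗ.[ℂ] E} (h : Dense (T.domain : Set E)) :
    Dense ((dblPMap T).domain : Set (Dbl E)) := by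
  have h1 : Dense (univ.pi fun _ : Fin 2 => (T.domain : Set E)) := dense_pi _ fun _ _ => h
  have h2 := h1.preimage (PiLp.continuousLinearEquiv 2 ℂ (fun _ : Fin 2 => E)).toHomeomorph.isOpenMap
  convert h2 using 1
  ext Ψ
  exact ⟨fun h j _ => h j, fun h j => h j trivial⟩

end Double

/-! ### Point interactions -/

section Point

variable {n : ℕ}

theorem kerTrace_le_freeH (y : Fin n → ℝ) : kerTrace y ≤ freeH.domain := fun _ h => h.1

/-- The trace `τ̂𝟙` for the free operator `H𝟙`. -/
def freeTraceData (y : Fin n → ℝ) (hy : Function.Injective y) :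
    TraceData (Dbl L2R) (C4n n) where
  A := dblPMap freeH
  S := dblPMap (opS y)
  dom :=
    { carrier := {Ψ | ∀ j, Ψ j ∈ traceDomain y}
      add_mem' := fun ha hb j => add_mem (ha j) (hb j)
      zero_mem' := fun _ => zero_mem _
      smul_mem' := fun c _ ha j => Submodule.smul_mem _ c (ha j) }
  τ := dblFun (traceHat y)
  G z := dblCLM (opG y z)
  rho := resSet freeH
  τ_add Ψ hΨ Φ hΦ := by
    refine PiLp.ext fun j => ?_
    exact ((hasTrace_traceHat (hΨ j)).add (hasTrace_traceHat (hΦ j))).trace_eq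
  τ_smul c Ψ hΨ := by
    refine PiLp.ext fun j => ?_
    exact ((hasTrace_traceHat (hΨ j)).smul c).trace_eq
  le_dom Ψ hΨ j := sobolevH2_le_traceDomain (hΨ j)
  G_mem z hz ξ j := by
    rw [resSet_freeH] at hz
    exact ⟨_, hasTrace_opG hz (ξ j)⟩
  symm Ψ Φ := by
    rw [PiLp.inner_apply, PiLp.inner_apply]
    exact Finset.sum_congr rfl fun j _ => freeH_isFormalAdjoint ⟨_, Ψ.2 j⟩ ⟨_, Φ.2 j⟩
  rho_sub z hz := ⟨_, isResolventAt_dbl (resOp_spec hz)⟩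
  conj_mem z hz := by
    rw [resSet_freeH] at hz ⊢
    exact conj_notMem hz
  I_mem := by
    rw [resSet_freeH]
    rintro ⟨t, -, h⟩
    simpa using congrArg Complex.im h
  G_adj z hz ξ Ψ := by
    rw [resSet_freeH] at hz
    rw [PiLp.inner_apply, PiLp.inner_apply]
    exact Finset.sum_congr rfl fun j _ => inner_opG hz (ξ j) ⟨_, Ψ.2 j⟩
  τG_adj z hz ξ η := by
    rw [resSet_freeH] at hz
    rw [PiLp.inner_apply, PiLp.inner_apply]
    refine Finset.sum_congr rfl fun j _ => ?_
    change ⟪traceHat y (opG y z (ξ j)), η j⟫_ℂ = ⟪ξ j, traceHat y (opG y (conj z) (η j))⟫_ℂ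
    rw [(hasTrace_opG hz (ξ j)).trace_eq, (hasTrace_opG (conj_notMem hz) (η j)).trace_eq,
      inner_traceG hz]
  surj v := by
    choose f hf ht using fun j => exists_hasTrace hy (v j)
    exact ⟨WithLp.toLp 2 f, hf, by
      refine PiLp.ext fun j => ?_
      exact (ht j).trace_eq⟩
  S_le := by
    refine ⟨fun Ψ hΨ j => (hΨ j).2, fun Ψ Φ h => ?_⟩
    refine PiLp.ext fun j => ?_
    exact LinearPMap.domRestrict_le.2 (congrArg (fun Ψ : Dbl L2R => Ψ j) h)
  mem_S Ψ := by
    constructor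
    · intro h
      refine ⟨fun j => (h j).2, ?_⟩
      refine PiLp.ext fun j => ?_
      exact (h j).1.2.trace_eq
    · rintro ⟨h1, h2⟩ j
      have e : traceHat y (Ψ j) = 0 := congrArg (fun v : C4n n => v j) h2
      exact ⟨⟨h1 j, e ▸ hasTrace_traceHat (sobolevH2_le_traceDomain (h1 j))⟩, h1 j⟩
  dense := by
    refine dense_dblPMap ?_
    convert dense_kerTrace y using 2
    exact inf_eq_left.2 (kerTrace_le_freeH y)

/-- Couples are determined by their linear relations. -/
theorem Couple.eq_of_coupleRel {p q : Couple n}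
    (h : coupleRel p.proj p.theta = coupleRel q.proj q.theta) : p = q := by
  obtain ⟨P, hP, θ, hθ⟩ := p
  obtain ⟨Q, hQ, κ, hκ⟩ := q
  have hr : LinearMap.range P = LinearMap.range Q := by
    ext ξ
    rw [mem_range_iff_exists_mem_coupleRel (θ := θ) hP, mem_range_iff_exists_mem_coupleRel (θ := κ) hQ]
    simp only at h
    rw [h]
  obtain rfl : P = Q := (hP.ext_iff hQ).2 hr
  congr 1
  refine LinearMap.ext fun ξ => ?_
  have h1 : ((ξ : C4n n), (θ ξ : C4n n)) ∈ coupleRel P θ :=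
    (mem_coupleRel_iff ξ _).2 (Subtype.ext (proj_apply_range hP _))
  simp only at h
  rw [h, mem_coupleRel_iff] at h1
  rw [← h1]
  exact (Subtype.ext (proj_apply_range hP _)).symm

theorem rank_C4n (n : ℕ) : Module.rank ℂ (C4n n) = 4 * n := by
  rw [← Module.finrank_eq_rank, (WithLp.linearEquiv 2 ℂ (Fin 2 → C2n n)).finrank_eq,
    Module.finrank_pi_fintype]
  simp
  norm_cast
  ring_nf

end Point

end PointInteraction

end

open PointInteraction
theorem theorem2p2 (n : ℕ) (y : Fin n → ℝ) (hy : StrictMono y) :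
    -- the free operator and `Ĝ_z = (τ̂ (-H + z̄)⁻¹)*`
    (resSet freeH = {z : ℂ | ¬ ∃ t : ℝ, 0 ≤ t ∧ z = t}) ∧
    (∀ z ∈ resSet freeH, ∀ (ξ : C2n n) (ψ : L2R),
      ⟪opG y z ξ, ψ⟫_ℂ = ⟪ξ, traceHat y (resOp freeH (conj z) ψ)⟫_ℂ) ∧
    -- `Ŝ𝟙` is a densely defined, closed, symmetric operator with defect indices `(4n, 4n)`
    Dense ((dblPMap (opS y)).domain : Set (Dbl L2R)) ∧
    (dblPMap (opS y)).IsClosed ∧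
    (dblPMap (opS y)).IsFormalAdjoint (dblPMap (opS y)) ∧
    Module.rank ℂ (defectSpace (dblPMap (opS y)) Complex.I) = 4 * n ∧
    Module.rank ℂ (defectSpace (dblPMap (opS y)) (-Complex.I)) = 4 * n ∧
    -- the family of the self-adjoint extensions of `Ŝ𝟙`
    ∃ Hhat : Couple n → (Dbl L2R →ₗ.[ℂ] Dbl L2R),
      BijOn Hhat univ {A | IsSelfAdjoint A ∧ dblPMap (opS y) ≤ A} ∧
      ∀ p : Couple n,
        -- the resolvent formula
        (∀ z ∈ resSet (Hhat p) ∩ resSet freeH,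
          ∃ hΓ : Function.Bijective (p.gamma y z), ∀ Ψ : Dbl L2R,
            resOp (Hhat p) z Ψ = dblFun (resOp freeH z) Ψ +
              dblFun (opG y z) ((Equiv.ofBijective _ hΓ).symm (p.proj.rangeRestrict
                (dblFun (ContinuousLinearMap.adjoint (opG y (conj z))) Ψ)))) ∧
        -- the domain, for every `z`
        (∀ z ∈ resSet freeH, ∀ Ψ : Dbl L2R, Ψ ∈ (Hhat p).domain ↔
          ∃ Ψz ∈ (dblPMap freeH).domain, ∃ ξ : LinearMap.range p.proj,
            Ψ = Ψz + dblFun (opG y z) ξ ∧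
            p.proj.rangeRestrict (dblFun (traceHat y) Ψ) = p.theta ξ) ∧
        -- the action
        (∀ z ∈ resSet freeH, ∀ (Ψ : (Hhat p).domain) (Ψz : (dblPMap freeH).domain)
          (ξ : LinearMap.range p.proj), (Ψ : Dbl L2R) = Ψz + dblFun (opG y z) ξ →
            -(Hhat p Ψ) + z • (Ψ : Dbl L2R) =
              -(dblPMap freeH Ψz) + z • (Ψz : Dbl L2R)) ∧
        -- uniqueness of the decomposition, and independence of `ξ` from `z`
        (∀ z ∈ resSet freeH, ∀ w ∈ resSet freeH,
          ∀ Ψz ∈ (dblPMap freeH).domain, ∀ Ψw ∈ (dblPMap freeH).domain,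
          ∀ ξ η : LinearMap.range p.proj,
            Ψz + dblFun (opG y z) ξ = Ψw + dblFun (opG y w) η →
              ξ = η ∧ (z = w → Ψz = Ψw)) := by
  have hinj := hy.injective
  set D := freeTraceData y hinj with hD
  refine ⟨resSet_freeH, fun z hz ξ ψ => ?_, D.dense, TraceData.isClosed_S (D := D), fun Ψ Φ => ?_,
    (TraceData.rank_defectSpace (D := D) D.I_mem).trans (rank_C4n n), ?_,
    fun p => D.ext (coupleRel p.proj p.theta), ⟨fun p _ => ?_, fun p _ q _ h => ?_, ?_⟩,
    fun p => ⟨fun z hz => ?_, fun z hz Ψ => ?_, fun z hz Ψ Ψz ξ e => ?_, ?_⟩⟩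
  · have hz' := D.conj_mem z hz
    obtain ⟨h, e⟩ := (resOp_spec hz').1 ψ
    rw [resSet_freeH] at hz
    have := inner_opG (y := y) hz ξ ⟨_, h⟩
    rwa [e] at this
  · have e : ∀ Ψ : D.S.domain, D.S Ψ = D.A ⟨Ψ, D.S_le.1 Ψ.2⟩ := fun Ψ => D.S_le.2 rfl
    exact (e Ψ).symm ▸ (e Φ).symm ▸ D.symm ⟨Ψ, D.S_le.1 Ψ.2⟩ ⟨Φ, D.S_le.1 Φ.2⟩
  · have := D.conj_mem _ D.I_mem
    rw [Complex.conj_I] at this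
    exact (TraceData.rank_defectSpace (D := D) this).trans (rank_C4n n)
  · exact ⟨TraceData.isSelfAdjoint_ext (relAdjoint_coupleRel p.isProj p.isSymm),
      TraceData.S_le_ext (D := D)⟩
  · exact Couple.eq_of_coupleRel (TraceData.ext_injective h)
  · rintro T ⟨hT, hS⟩
    obtain ⟨L, hL, rfl⟩ := TraceData.exists_eq_ext (D := D) hT hS
    obtain ⟨P, θ, hP, hθ, rfl⟩ := exists_coupleRel_eq hL
    exact ⟨⟨P, hP, θ, hθ⟩, trivial, rfl⟩
  · have hb : Function.Bijective (p.gamma y z) := TraceData.bijective_gamma (D := D) hz.2 hz.1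
    refine ⟨hb, fun Ψ => ?_⟩
    have h := TraceData.resOp_ext (D := D) hz.2 hz.1 Ψ
      ((Equiv.ofBijective _ hb).symm (p.proj.rangeRestrict
        (dblFun (ContinuousLinearMap.adjoint (opG y (conj z))) Ψ))) (by
          rw [← adjoint_dblCLM]
          exact (Equiv.ofBijective _ hb).apply_symm_apply _)
    rw [h]
    congr 1
    change resOp (dblPMap freeH) z Ψ = _
    rw [resOp_dbl hz.2]
    rfl
  · exact TraceData.mem_ext_coupleRel (D := D) hz
  · exact TraceData.ext_action (D := D) hz Ψ Ψz ξ e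
  · intro z hz w hw Ψz hΨz Ψw hΨw ξ η e
    have h1 := TraceData.hasCharge_add (D := D) hz ⟨Ψz, hΨz⟩ ξ
    have h2 := TraceData.hasCharge_add (D := D) hw ⟨Ψw, hΨw⟩ η
    have h3 : D.HasCharge (Ψz + D.G z ξ) η := by
      rw [show Ψz + D.G z ξ = Ψw + D.G w η from e]
      exact h2
    have h4 : ξ = η := Subtype.ext (h1.unique h3)
    refine ⟨h4, ?_⟩
    rintro rfl
    rw [h4] at e
    exact add_right_cancel e
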